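/- Let $F$ be a field of characteristic different from $2$, let $V$ be a finite-dimensional vector space over $F$ and let $\mathfrak P$ be the projective space of $V$. Let $\varpi$ be a polarity of $\mathfrak P$, put $$Q_0(\varpi)=\{p : p\in\varpi(p)\},\qquad Q_m(\varpi)=\Big\{X : X \text{ an } m\text{-dimensional projective subspace of } \mathfrak P,\ X\subseteq \bigcap_{p\in X}\varpi(p)\Big\}\quad (m\ge 1),$$ and assume that either $\varpi$ is symplectic (given by a nondegenerate alternating bilinear form) with $Q_1(\varpi)\neq\emptyset$, or $\varpi$ is quadratic (given by a nondegenerate symmetric bilinear form) with $Q_2(\varpi)\ne\emptyset$. Let $\mathbf Q(\varpi)=\langle Q_0(\varpi),Q_1(\varpi)\rangle$ be the polar space of $\varpi$. Let $\varkappa$ be a symplectic polarity of $\mathfrak P$. Let $\mathfrak M=\mathbf V_2(\mathbf Q(\varpi))$ be the Veronese space of level $2$: its points are the two-element multisets $x+y$ with $x,y\in Q_0(\varpi)$, and its lines are the sets $\{a+x: x\in L\}$ and $\{2x:x\in L\}$ with $a\in Q_0(\varpi)$, $L\in Q_1(\varpi)$. Let $\mathcal H=\{x+y : x,y\in Q_0(\varpi),\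 y\in\varkappa(x)\}$ be the hyperplane of $\mathfrak M$ induced by $\varkappa$. The affine reduct $\mathfrak M\setminus\mathcal H$ is the structure whose points are the points of $\mathfrak M$ not in $\mathcal H$, whose lines are the sets $L\setminus\mathcal H$ for lines $L\not\subseteq\mathcal H$ of $\mathfrak M$, with incidence and with the parallelism $(L_1\setminus\mathcal H)\parallel (L_2\setminus\mathcal H)\iff L_1\cap\mathcal H=L_2\cap\mathcal H$. Theorem. The Veronese space $\mathfrak M$ can be defined in terms of its affine reduct $\mathfrak M\setminus\mathcal H$. That is, there are first-order formulas without parameters in the language of points, lines, incidence and parallelism, the same for all $F,V,\varpi,\varkappa$ as above, which, read in $\mathfrak M\setminus\mathcal H$, interpret $\mathfrak M$: they define which tuples of points and lines of $\mathfrak M\setminus\mathcal H$ code points and lines of $\mathfrak M$ (every point and every line of $\mathfrak M$ having a code), when two tuples code the same point or the same line, when a coded point lies on a coded line of $\mathfrak M$, and when a tuple codes a given point of $\mathfrak M\setminus\mathcal H$ (regarded as a point of $\mathfrak M$). -/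

import Mathlib

open LinearAlgebra.Projectivization

namespace Veronese

/-! ## Incidence structures and Veronese spaces -/

/-- An incidence structure on the point set `S`, its lines being sets of points. -/
structure PointLineSpace (S : Type*) where
  lines : Set (Set S)

/-- The `k`-th Veronese space over `W`. Its points are the `k`-element multisets of points of `W`,
its lines are the sets `{e + r x : x ∈ B}`, where `0 < r ≤ k`, `e` is a multiset with `k - r`
elements and `B` is a line of `W`. -/
def PointLineSpace.veronese {S : Type*} (k : ℕ) (W : PointLineSpace S) :
    PointLineSpace (Sym S k) where
  lines := {T | ∃ r : ℕ, 0 < r ∧ r ≤ k ∧ ∃ e : Multiset S, e.card = k - r ∧ ∃ B ∈ W.lines,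
    T = {f : Sym S k | ∃ x ∈ B, (f : Multiset S) = e + Multiset.replicate r x}}

/-! ## Affine reducts -/

/-- An incidence structure with a binary relation (a parallelism) on its lines. -/
structure ParallelSpace (S : Type*) extends PointLineSpace S where
  par : lines → lines → Prop

/-- The affine reduct `M ∖ H = ⟨S ∖ H, {L ∖ H : L ⊈ H}, ∥_H⟩`, where two lines of the reduct are
parallel when the lines of `M` that they come from have the same points in `H`. -/
def PointLineSpace.affineReduct {S : Type*} (M : PointLineSpace S) (H : Set S) :
    ParallelSpace {p : S // p ∉ H} where
  lines := {l | ∃ L ∈ M.lines, ¬ L ⊆ H ∧ l = Subtype.val ⁻¹' L}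
  par l₁ l₂ := ∃ L₁ ∈ M.lines, ∃ L₂ ∈ M.lines, ¬ L₁ ⊆ H ∧ ¬ L₂ ⊆ H ∧
    (l₁ : Set {p : S // p ∉ H}) = Subtype.val ⁻¹' L₁ ∧
    (l₂ : Set {p : S // p ∉ H}) = Subtype.val ⁻¹' L₂ ∧ L₁ ∩ H = L₂ ∩ H

/-! ## Polarities and polar spaces -/

section Projective

variable {F V : Type*} [Field F] [AddCommGroup V] [Module F V]

/-- The set of points of the projective space of `V` that lie in the linear subspace `W`. -/
def pointsOf (W : Submodule F V) : Set (ℙ F V) :=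
  {p | p.submodule ≤ W}

/-- The `m`-dimensional projective subspaces: `m = 1` gives lines, `m = 2` planes. -/
def projSubspaces (F V : Type*) [Field F] [AddCommGroup V] [Module F V] (m : ℕ) :
    Set (Set (ℙ F V)) :=
  {X | ∃ W : Submodule F V, Module.finrank F W = m + 1 ∧ X = pointsOf W}

/-- The set of points conjugate to `p` under the form `ξ`. -/
def conjugates (ξ : LinearMap.BilinForm F V) (p : ℙ F V) : Set (ℙ F V) :=
  {q | ∀ u ∈ q.submodule, ∀ v ∈ p.submodule, ξ u v = 0}

/-- `κ` is a symplectic polarity: it is given by a nondegenerate alternating form. -/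
def IsSymplecticPolarity (κ : ℙ F V → Set (ℙ F V)) : Prop :=
  ∃ ξ : LinearMap.BilinForm F V, ξ.Nondegenerate ∧ ξ.IsAlt ∧ ∀ p, κ p = conjugates ξ p

/-- `ϖ` is a quadratic polarity: it is given by a nondegenerate symmetric form
(the characteristic of the field is different from two wherever this is used). -/
def IsQuadraticPolarity (ϖ : ℙ F V → Set (ℙ F V)) : Prop :=
  ∃ ξ : LinearMap.BilinForm F V, ξ.Nondegenerate ∧ ξ.IsSymm ∧ ∀ p, ϖ p = conjugates ξ p

/-- The set `Q₀(ϖ)` of self-conjugate points. -/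
def selfConjPoints (ϖ : ℙ F V → Set (ℙ F V)) : Set (ℙ F V) :=
  {p | p ∈ ϖ p}

/-- The set `Qₘ(ϖ)` of self-conjugate `m`-dimensional projective subspaces: those `X` with
`X ⊆ ϖ(X) = ⋂ p ∈ X, ϖ(p)`. -/
def selfConjSubspaces (ϖ : ℙ F V → Set (ℙ F V)) (m : ℕ) : Set (Set (ℙ F V)) :=
  {X ∈ projSubspaces F V m | X ⊆ ⋂ p ∈ X, ϖ p}

/-- The structure `Q(ϖ)` of self-conjugate points and self-conjugate lines of `ϖ`. -/
def polarSpace (ϖ : ℙ F V → Set (ℙ F V)) : PointLineSpace (selfConjPoints ϖ) where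
  lines := {T | ∃ L ∈ selfConjSubspaces ϖ 1, T = Subtype.val ⁻¹' L}

/-- The polarities whose structure `Q(ϖ)` is a polar space: the symplectic ones that have
self-conjugate lines, and the quadratic ones that have self-conjugate planes. -/
def DeterminesPolarSpace (ϖ : ℙ F V → Set (ℙ F V)) : Prop :=
  (IsSymplecticPolarity ϖ ∧ (selfConjSubspaces ϖ 1).Nonempty) ∨
    (IsQuadraticPolarity ϖ ∧ (selfConjSubspaces ϖ 2).Nonempty)

/-- The set `{x + y : y ∈ κ(x)}` of points of the second Veronese space over the projective space
of `V`. -/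
def inducedHyperplane (κ : ℙ F V → Set (ℙ F V)) : Set (Sym (ℙ F V) 2) :=
  {e | ∃ x y : ℙ F V, y ∈ κ x ∧ (e : Multiset (ℙ F V)) = {x} + {y}}

/-- The restriction of the induced hyperplane to the points of `V₂(Q(ϖ))`. -/
def polarHyperplane (ϖ κ : ℙ F V → Set (ℙ F V)) : Set (Sym (selfConjPoints ϖ) 2) :=
  {e | e.map Subtype.val ∈ inducedHyperplane κ}

end Projective

/-! ## First-order definability -/

/-- The relation symbols of the language of incidence structures with a parallelism. -/
inductive AffineRel : ℕ → Type
  | point : AffineRel 1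
  | inc : AffineRel 2
  | par : AffineRel 2

/-- The first-order language of points and lines with incidence and parallelism. -/
def affineLanguage : FirstOrder.Language.{0, 0} where
  Functions := fun _ => Empty
  Relations := AffineRel

/-- The universe of `A` as a first-order structure: its points together with its lines. -/
def ParallelSpace.Elem {S : Type*} (A : ParallelSpace S) : Type _ :=
  S ⊕ A.lines

/-- A point as an element of the universe. -/
def ParallelSpace.ofPoint {S : Type*} (A : ParallelSpace S) (p : S) : A.Elem :=
  Sum.inl p

instance {S : Type*} (A : ParallelSpace S) : affineLanguage.Structure A.Elem where
  funMap := fun f _ => f.elim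
  RelMap := fun {_} R => match R with
    | AffineRel.point => fun v => ∃ p : S, v 0 = Sum.inl p
    | AffineRel.inc => fun v => ∃ (p : S) (l : A.lines),
        v 0 = Sum.inl p ∧ v 1 = Sum.inr l ∧ p ∈ (l : Set S)
    | AffineRel.par => fun v => ∃ l₁ l₂ : A.lines,
        v 0 = Sum.inr l₁ ∧ v 1 = Sum.inr l₂ ∧ A.par l₁ l₂

/-- The formulas (without parameters) of a first-order interpretation of a two-sorted incidence
structure: points are coded by `n`-tuples and lines by `m`-tuples. -/
structure IncidenceDefinition where
  n : ℕ
  m : ℕ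
  /-- the tuples that code points -/
  isPoint : affineLanguage.Formula (Fin n)
  /-- the tuples that code lines -/
  isLine : affineLanguage.Formula (Fin m)
  /-- two tuples code the same point -/
  samePoint : affineLanguage.Formula (Fin n ⊕ Fin n)
  /-- two tuples code the same line -/
  sameLine : affineLanguage.Formula (Fin m ⊕ Fin m)
  /-- the coded point lies on the coded line -/
  incident : affineLanguage.Formula (Fin n ⊕ Fin m)
  /-- the tuple codes the given point of the affine reduct -/
  proper : affineLanguage.Formula (Unit ⊕ Fin n)

/-- The formulas `D`, read in the affine reduct `M ∖ H`, define `M` together with the inclusion of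
the points of `M ∖ H` in those of `M`. -/
def IncidenceDefinition.Defines {S : Type*} (D : IncidenceDefinition) (M : PointLineSpace S)
    (H : Set S) : Prop :=
  ∃ (f : {x : Fin D.n → (M.affineReduct H).Elem // D.isPoint.Realize x} → S)
    (g : {y : Fin D.m → (M.affineReduct H).Elem // D.isLine.Realize y} → M.lines),
    Function.Surjective f ∧ Function.Surjective g ∧
    (∀ x x', D.samePoint.Realize (Sum.elim x.1 x'.1) ↔ f x = f x') ∧
    (∀ y y', D.sameLine.Realize (Sum.elim y.1 y'.1) ↔ g y = g y') ∧
    (∀ x y, D.incident.Realize (Sum.elim x.1 y.1) ↔ f x ∈ (g y : Set S)) ∧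
    (∀ (a : {p : S // p ∉ H}) x,
      D.proper.Realize (Sum.elim (fun _ => (M.affineReduct H).ofPoint a) x.1) ↔
        f x = a)

end Veronese

/-!
Let `ξ` and `η` be the forms of `ϖ` and `κ`. A point of the affine reduct is a sum `x + y` of
isotropic points with `η(x, y) ≠ 0` (`x` and `y` are *far* from each other), and its lines are the
sets `a + L`, where some point of `L` is far from `a`; a line `{2x : x ∈ L}` lies in the hyperplane,
since `η` is alternating. So a line `a + L` of the reduct can serve as a name of the point `a` (it
belongs to the *leaf* of `a`) and of the line `L` (its *axis*). Every point and every line of the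
polar space has such names, and the points `x + y` and the lines `a + L`, `{2x : x ∈ L}` of the
Veronese space are coded by tuples of them. Once it can be expressed that two lines of the reduct
lie in the same leaf, everything else can: for `x ∈ L` far from `a`, the point `a + x` lies on the
line `a + L` and on some line of the leaf of `x`, which expresses that `x` belongs to the axis of
`a + L` (`PolarPair.onAffine_iff`). In this way `L` is known up to the one point that need not be
far from `a`, and as lines have at least four points, two common points decide whether two axes are
equal (`PolarPair.sameAxis_iff`).

Parallelism is not needed. For lines through a common point `x + y` the leaves are told apart by
joinability (`PolarPair.sameLeafAt_iff`). Points of `x + L` and `y + M` that are joined, and different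
from `x + y`, are of the form `x + u`, `y + u`, so a point of one line is joined to at most one
further point of the other, whereas in a totally isotropic plane all points are joined. If the
polar space has planes, two lines of one leaf that meet are coplanar, or coplanar with a third line.
If it has no planes, then the form is alternating and a count of common neighbours decides: `x + u`
and `x + v` with `u`, `v` not orthogonal have at least the three common neighbours `x + w` with `w`
in a two-dimensional space orthogonal to `u` and `v`, whereas `x + u` on `x + L` and `y + v`
on `y + M` can be chosen to be joined, if `L = M`, and otherwise to have no common neighbours but
`x + y` and `u + v`. Finally, two lines of the leaf of `x` are linked by a chain of bounded length (`IsPolarForm.exists_link`): a linear functional that vanishes on all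
isotropic vectors orthogonal to a hyperbolic pair is a combination of the functionals of this pair,
as isotropic vectors span, so that the hyperplane `η(x, ·) = 0` cannot block all paths.

The combinatorial part of the argument is carried out from the list `PolarPair` of properties of a
polar space and a hyperplane; `polarPair_of_isPolarForm` derives them from the forms.
-/

namespace Veronese

/-! ### First-order notions of incidence geometry -/

section Incidence

variable {E : Type*} (I : E → E → Prop)

/-- `a` and `b` are points of a common line (so every point of a line is joined to itself). -/
def Joined (a b : E) : Prop := ∃ l, I a l ∧ I b l

/-- `l` and `m` are distinct lines through `p`, and some further point of `l` is joined to two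
further points of `m`. -/
def PlanarAt (p l m : E) : Prop :=
  l ≠ m ∧ I p l ∧ I p m ∧ ∃ a b c, a ≠ p ∧ b ≠ p ∧ c ≠ p ∧ b ≠ c ∧ I a l ∧ I b m ∧ I c m ∧
    Joined I a b ∧ Joined I a c

/-- There are three distinct points that are joined both to `a` and to `b`. -/
def ThreeCommon (a b : E) : Prop :=
  ∃ c d e, c ≠ d ∧ c ≠ e ∧ d ≠ e ∧ Joined I a c ∧ Joined I b c ∧ Joined I a d ∧ Joined I b d ∧
    Joined I a e ∧ Joined I b e

/-- Some point of `l` and some point of `m`, both different from `p`, are joined or have at most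
two common neighbours. -/
def CrossAt (p l m : E) : Prop :=
  ∃ a b, a ≠ p ∧ b ≠ p ∧ I a l ∧ I b m ∧ (Joined I a b ∨ ¬ ThreeCommon I a b)

/-- The lines `l` and `m` through `p` lie in the same leaf. The last alternative is meant for spaces
without planes. -/
def SameLeafAt (p l m : E) : Prop :=
  I p l ∧ I p m ∧ (l = m ∨ PlanarAt I p l m ∨ (∃ n, PlanarAt I p l n ∧ PlanarAt I p n m) ∨
    (¬ (∃ n, PlanarAt I p l n) ∧ ¬ CrossAt I p l m))

/-- The lines `l` and `m` lie in the same leaf: they are linked by a chain of lines of one leaf. -/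
def SameLeaf (l m : E) : Prop :=
  ∃ n k p q r, SameLeafAt I p l n ∧ SameLeafAt I q n k ∧ SameLeafAt I r k m

/-- For `k` in the leaf of `x` and `l = a + L`: the point `x` belongs to `L`, and `a + x` is a point
of the affine reduct. -/
def OnAffine (k l : E) : Prop :=
  ¬ SameLeaf I k l ∧ ∃ p m, I p l ∧ I p m ∧ SameLeaf I m k

/-- The lines `l = a + L` and `m = b + M` satisfy `L = M`. -/
def SameAxis (l m : E) : Prop :=
  ∃ k n, ¬ SameLeaf I k n ∧ OnAffine I k l ∧ OnAffine I k m ∧ OnAffine I n l ∧ OnAffine I n m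

/-- For `k` in the leaf of `x` and `l = a + L`: the point `x` belongs to `L`. -/
def OnAxis (k l : E) : Prop := ∃ m, SameAxis I m l ∧ OnAffine I k m

/-- `l` is a line: some point lies on it. -/
def IsLine (l : E) : Prop := ∃ p, I p l

end Incidence

/-! ### Formulas with named variables -/

namespace NamedFormula

open FirstOrder FirstOrder.Language

/-- The existential quantifier that binds the variable with number `n`. -/
def ex (n : ℕ) (φ : affineLanguage.Formula ℕ) : affineLanguage.Formula ℕ :=
  (BoundedFormula.relabel (n := 1) (k := 0)
    (fun i => if i = n then Sum.inr 0 else Sum.inl i) φ).ex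

def eq (i j : ℕ) : affineLanguage.Formula ℕ := (Term.var i).equal (Term.var j)

def inc (i j : ℕ) : affineLanguage.Formula ℕ :=
  Relations.formula₂ (L := affineLanguage) AffineRel.inc (Term.var i) (Term.var j)

/-! Each formula below expresses the notion of the same name for the variables with the given numbers,
which are to be smaller than `n`; the variables from number `n` on serve as bound variables. -/

def joined (n i j : ℕ) : affineLanguage.Formula ℕ := ex n (inc i n ⊓ inc j n)

def planarAt (n p l m : ℕ) : affineLanguage.Formula ℕ :=
  (eq l m).not ⊓ (inc p l ⊓ (inc p m ⊓ ex n (ex (n + 1) (ex (n + 2)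
    ((eq n p).not ⊓ ((eq (n + 1) p).not ⊓ ((eq (n + 2) p).not ⊓ ((eq (n + 1) (n + 2)).not ⊓
      (inc n l ⊓ (inc (n + 1) m ⊓ (inc (n + 2) m ⊓
        (joined (n + 3) n (n + 1) ⊓ joined (n + 3) n (n + 2)))))))))))))

def threeCommon (n a b : ℕ) : affineLanguage.Formula ℕ :=
  ex n (ex (n + 1) (ex (n + 2) ((eq n (n + 1)).not ⊓ ((eq n (n + 2)).not ⊓
    ((eq (n + 1) (n + 2)).not ⊓ (joined (n + 3) a n ⊓ (joined (n + 3) b n ⊓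
      (joined (n + 3) a (n + 1) ⊓ (joined (n + 3) b (n + 1) ⊓
        (joined (n + 3) a (n + 2) ⊓ joined (n + 3) b (n + 2)))))))))))

def crossAt (n p l m : ℕ) : affineLanguage.Formula ℕ :=
  ex n (ex (n + 1) ((eq n p).not ⊓ ((eq (n + 1) p).not ⊓ (inc n l ⊓ (inc (n + 1) m ⊓
    (joined (n + 2) n (n + 1) ⊔ (threeCommon (n + 2) n (n + 1)).not))))))

def sameLeafAt (n p l m : ℕ) : affineLanguage.Formula ℕ :=
  inc p l ⊓ (inc p m ⊓ (eq l m ⊔ (planarAt n p l m ⊔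
    (ex n (planarAt (n + 1) p l n ⊓ planarAt (n + 1) p n m) ⊔
      ((ex n (planarAt (n + 1) p l n)).not ⊓ (crossAt n p l m).not)))))

def sameLeaf (n l m : ℕ) : affineLanguage.Formula ℕ :=
  ex n (ex (n + 1) (ex (n + 2) (ex (n + 3) (ex (n + 4)
    (sameLeafAt (n + 5) (n + 2) l n ⊓ (sameLeafAt (n + 5) (n + 3) n (n + 1) ⊓
      sameLeafAt (n + 5) (n + 4) (n + 1) m))))))

def onAffine (n k l : ℕ) : affineLanguage.Formula ℕ :=
  (sameLeaf n k l).not ⊓ ex n (ex (n + 1) (inc n l ⊓ (inc n (n + 1) ⊓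
    sameLeaf (n + 2) (n + 1) k)))

def sameAxis (n l m : ℕ) : affineLanguage.Formula ℕ :=
  ex n (ex (n + 1) ((sameLeaf (n + 2) n (n + 1)).not ⊓ (onAffine (n + 2) n l ⊓
    (onAffine (n + 2) n m ⊓ (onAffine (n + 2) (n + 1) l ⊓ onAffine (n + 2) (n + 1) m)))))

def onAxis (n k l : ℕ) : affineLanguage.Formula ℕ :=
  ex n (sameAxis (n + 1) n l ⊓ onAffine (n + 1) k n)

def isLine (n l : ℕ) : affineLanguage.Formula ℕ := ex n (inc n l)

section Realize

variable {E : Type*} [affineLanguage.Structure E]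

/-- The incidence relation of a structure for the language. -/
def Inc (a b : E) : Prop :=
  Structure.RelMap (L := affineLanguage) (n := 2) AffineRel.inc ![a, b]

@[simp] theorem realize_ex (n : ℕ) (φ : affineLanguage.Formula ℕ) (v : ℕ → E) :
    (ex n φ).Realize v ↔ ∃ a, φ.Realize (Function.update v n a) := by
  rw [ex, Formula.Realize, BoundedFormula.realize_ex]
  refine exists_congr fun a => ?_
  rw [BoundedFormula.realize_relabel, Formula.Realize]
  refine iff_of_eq (congr (congrArg _ (funext fun i => ?_)) (Subsingleton.elim _ _))
  by_cases h : i = n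
  · subst h; simp [Fin.snoc]
  · simp [h]

@[simp] theorem realize_eq (i j : ℕ) (v : ℕ → E) : (eq i j).Realize v ↔ v i = v j := by
  simp [eq]

@[simp] theorem realize_inc (i j : ℕ) (v : ℕ → E) : (inc i j).Realize v ↔ Inc (v i) (v j) :=
  Formula.realize_rel₂ (L := affineLanguage) (R := AffineRel.inc) (t₁ := Term.var i)
    (t₂ := Term.var j)

theorem realize_joined {n i j : ℕ} (v : ℕ → E) (hi : i < n) (hj : j < n) :
    (joined n i j).Realize v ↔ Joined Inc (v i) (v j) := by
  simp (disch := omega) only [joined, Joined, realize_ex, Formula.realize_inf, realize_inc,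
    Function.update_self, Function.update_of_ne]

theorem realize_planarAt {n p l m : ℕ} (v : ℕ → E) (hp : p < n) (hl : l < n) (hm : m < n) :
    (planarAt n p l m).Realize v ↔ PlanarAt Inc (v p) (v l) (v m) := by
  simp (disch := omega) only [planarAt, PlanarAt, realize_ex, Formula.realize_inf, realize_inc,
    Formula.realize_not, realize_eq, realize_joined, Function.update_self, Function.update_of_ne,
    ne_eq]

theorem realize_threeCommon {n a b : ℕ} (v : ℕ → E) (ha : a < n) (hb : b < n) :
    (threeCommon n a b).Realize v ↔ ThreeCommon Inc (v a) (v b) := by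
  simp (disch := omega) only [threeCommon, ThreeCommon, realize_ex, Formula.realize_inf,
    Formula.realize_not, realize_eq, realize_joined, Function.update_self, Function.update_of_ne,
    ne_eq]

theorem realize_crossAt {n p l m : ℕ} (v : ℕ → E) (hp : p < n) (hl : l < n) (hm : m < n) :
    (crossAt n p l m).Realize v ↔ CrossAt Inc (v p) (v l) (v m) := by
  simp (disch := omega) only [crossAt, CrossAt, realize_ex, Formula.realize_inf, realize_inc,
    Formula.realize_not, Formula.realize_sup, realize_eq, realize_joined, realize_threeCommon,
    Function.update_self, Function.update_of_ne, ne_eq]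

theorem realize_sameLeafAt {n p l m : ℕ} (v : ℕ → E) (hp : p < n) (hl : l < n) (hm : m < n) :
    (sameLeafAt n p l m).Realize v ↔ SameLeafAt Inc (v p) (v l) (v m) := by
  simp (disch := omega) only [sameLeafAt, SameLeafAt, realize_ex, Formula.realize_inf, realize_inc,
    Formula.realize_not, Formula.realize_sup, realize_eq, realize_planarAt, realize_crossAt,
    Function.update_self, Function.update_of_ne]

theorem realize_sameLeaf {n l m : ℕ} (v : ℕ → E) (hl : l < n) (hm : m < n) :
    (sameLeaf n l m).Realize v ↔ SameLeaf Inc (v l) (v m) := by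
  simp (disch := omega) only [sameLeaf, SameLeaf, realize_ex, Formula.realize_inf,
    realize_sameLeafAt, Function.update_self, Function.update_of_ne]

theorem realize_onAffine {n k l : ℕ} (v : ℕ → E) (hk : k < n) (hl : l < n) :
    (onAffine n k l).Realize v ↔ OnAffine Inc (v k) (v l) := by
  simp (disch := omega) only [onAffine, OnAffine, realize_ex, Formula.realize_inf, realize_inc,
    Formula.realize_not, realize_sameLeaf, Function.update_self, Function.update_of_ne]

theorem realize_sameAxis {n l m : ℕ} (v : ℕ → E) (hl : l < n) (hm : m < n) :
    (sameAxis n l m).Realize v ↔ SameAxis Inc (v l) (v m) := by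
  simp (disch := omega) only [sameAxis, SameAxis, realize_ex, Formula.realize_inf,
    Formula.realize_not, realize_sameLeaf, realize_onAffine, Function.update_self,
    Function.update_of_ne]

theorem realize_onAxis {n k l : ℕ} (v : ℕ → E) (hk : k < n) (hl : l < n) :
    (onAxis n k l).Realize v ↔ OnAxis Inc (v k) (v l) := by
  simp (disch := omega) only [onAxis, OnAxis, realize_ex, Formula.realize_inf,
    realize_sameAxis, realize_onAffine, Function.update_self, Function.update_of_ne]

theorem realize_isLine {n l : ℕ} (v : ℕ → E) (hl : l < n) :
    (isLine n l).Realize v ↔ IsLine Inc (v l) := by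
  simp (disch := omega) only [isLine, IsLine, realize_ex, realize_inc,
    Function.update_self, Function.update_of_ne]

end Realize

end NamedFormula

/-! ### The interpretation -/

section Interpretation

open NamedFormula

/-- A point of the Veronese space is coded by a pair of lines: it is the sum of the points whose
leaves contain them. A line is coded by a triple: when its last entry is a line, then
`(a + K, b + L, _)` codes `a + L`, and when it is a point, then `(a + K, b + L, _)` codes
`{2x : x ∈ L}`. -/
def veroneseDefinition : IncidenceDefinition where
  n := 2
  m := 3
  isPoint := (isLine 2 0 ⊓ isLine 2 1).relabel fun i => if i = 0 then 0 else 1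
  isLine := (isLine 2 0 ⊓ isLine 2 1).relabel fun i => if i = 0 then 0 else 1
  samePoint := ((sameLeaf 4 0 2 ⊓ sameLeaf 4 1 3) ⊔ (sameLeaf 4 0 3 ⊓ sameLeaf 4 1 2)).relabel
    fun i => if i = 0 then Sum.inl 0 else if i = 1 then Sum.inl 1 else
      if i = 2 then Sum.inr 0 else Sum.inr 1
  sameLine := (sameAxis 6 1 4 ⊓ ((isLine 6 2 ⊓ (isLine 6 5 ⊓ sameLeaf 6 0 3)) ⊔
      ((isLine 6 2).not ⊓ (isLine 6 5).not))).relabel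
    fun i => if i = 0 then Sum.inl 0 else if i = 1 then Sum.inl 1 else if i = 2 then Sum.inl 2 else
      if i = 3 then Sum.inr 0 else if i = 4 then Sum.inr 1 else Sum.inr 2
  incident := ((isLine 5 4 ⊓ ((sameLeaf 5 0 2 ⊓ onAxis 5 1 3) ⊔ (sameLeaf 5 1 2 ⊓ onAxis 5 0 3))) ⊔
      ((isLine 5 4).not ⊓ (sameLeaf 5 0 1 ⊓ onAxis 5 0 3))).relabel
    fun i => if i = 0 then Sum.inl 0 else if i = 1 then Sum.inl 1 else
      if i = 2 then Sum.inr 0 else if i = 3 then Sum.inr 1 else Sum.inr 2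
  proper := ((sameLeaf 3 1 2).not ⊓ (ex 3 (ex 4 (inc 0 3 ⊓ (inc 0 4 ⊓
      (sameLeaf 5 3 1 ⊓ sameLeaf 5 4 2)))))).relabel
    fun i => if i = 0 then Sum.inl () else if i = 1 then Sum.inr 0 else Sum.inr 1

variable {E : Type*} [affineLanguage.Structure E]

theorem realize_isPoint (x : Fin 2 → E) :
    veroneseDefinition.isPoint.Realize x ↔ IsLine Inc (x 0) ∧ IsLine Inc (x 1) := by
  simp [veroneseDefinition, realize_isLine]

theorem realize_isLine (y : Fin 3 → E) :
    veroneseDefinition.isLine.Realize y ↔ IsLine Inc (y 0) ∧ IsLine Inc (y 1) := by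
  simp [veroneseDefinition, NamedFormula.realize_isLine]

theorem realize_samePoint (x x' : Fin 2 → E) :
    veroneseDefinition.samePoint.Realize (Sum.elim x x') ↔
      SameLeaf Inc (x 0) (x' 0) ∧ SameLeaf Inc (x 1) (x' 1) ∨
        SameLeaf Inc (x 0) (x' 1) ∧ SameLeaf Inc (x 1) (x' 0) := by
  simp [veroneseDefinition, realize_sameLeaf]

theorem realize_sameLine (y y' : Fin 3 → E) :
    veroneseDefinition.sameLine.Realize (Sum.elim y y') ↔
      SameAxis Inc (y 1) (y' 1) ∧
        (IsLine Inc (y 2) ∧ IsLine Inc (y' 2) ∧ SameLeaf Inc (y 0) (y' 0) ∨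
          ¬ IsLine Inc (y 2) ∧ ¬ IsLine Inc (y' 2)) := by
  simp [veroneseDefinition, realize_sameLeaf, realize_sameAxis, NamedFormula.realize_isLine]

theorem realize_incident (x : Fin 2 → E) (y : Fin 3 → E) :
    veroneseDefinition.incident.Realize (Sum.elim x y) ↔
      IsLine Inc (y 2) ∧ (SameLeaf Inc (x 0) (y 0) ∧ OnAxis Inc (x 1) (y 1) ∨
          SameLeaf Inc (x 1) (y 0) ∧ OnAxis Inc (x 0) (y 1)) ∨
        ¬ IsLine Inc (y 2) ∧ SameLeaf Inc (x 0) (x 1) ∧ OnAxis Inc (x 0) (y 1) := by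
  simp [veroneseDefinition, realize_sameLeaf, realize_onAxis, NamedFormula.realize_isLine]

theorem realize_proper (a : E) (x : Fin 2 → E) :
    veroneseDefinition.proper.Realize (Sum.elim (fun _ => a) x) ↔
      ¬ SameLeaf Inc (x 0) (x 1) ∧
        ∃ l m, Inc a l ∧ Inc a m ∧ SameLeaf Inc l (x 0) ∧ SameLeaf Inc m (x 1) := by
  simp [veroneseDefinition, realize_sameLeaf]

end Interpretation

/-! ### Sums of two points and affine reducts -/

section Reduct

variable {S : Type*}

/-- The point `x + y` of the second Veronese space. -/
def pair (x y : S) : Sym S 2 := ⟨{x, y}, rfl⟩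

theorem pair_comm (x y : S) : pair x y = pair y x :=
  Subtype.ext (Multiset.pair_comm x y)

theorem pair_eq_pair {x y x' y' : S} :
    pair x y = pair x' y' ↔ (x = x' ∧ y = y') ∨ (x = y' ∧ y = x') := by
  refine ⟨fun h => ?_, ?_⟩
  · have h : ({x, y} : Multiset S) = {x', y'} := congrArg Subtype.val h
    simp only [Multiset.insert_eq_cons, Multiset.cons_eq_cons, Multiset.singleton_inj,
      Multiset.singleton_eq_cons_iff] at h
    rcases h with h | ⟨-, cs, ⟨rfl, rfl⟩, ⟨h, -⟩⟩
    · exact Or.inl h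
    · exact Or.inr ⟨h.symm, rfl⟩
  · rintro (⟨rfl, rfl⟩ | ⟨rfl, rfl⟩)
    · rfl
    · exact pair_comm _ _

theorem exists_pair (e : Sym S 2) : ∃ x y, e = pair x y := by
  obtain ⟨m, hm⟩ := e
  obtain ⟨x, y, rfl⟩ := Multiset.card_eq_two.1 hm
  exact ⟨x, y, rfl⟩

/-- The line `{a + x : x ∈ L}` of the second Veronese space. -/
def leafLine (a : S) (L : Set S) : Set (Sym S 2) := {f | ∃ x ∈ L, f = pair a x}

/-- The line `{2x : x ∈ L}` of the second Veronese space. -/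
def doubleLine (L : Set S) : Set (Sym S 2) := {f | ∃ x ∈ L, f = pair x x}

theorem mem_veronese_two_lines {W : PointLineSpace S} {T : Set (Sym S 2)} :
    T ∈ (W.veronese 2).lines ↔ ∃ L ∈ W.lines, (∃ a, T = leafLine a L) ∨ T = doubleLine L := by
  have key : ∀ (a : S) (L : Set S),
      {f : Sym S 2 | ∃ x ∈ L, (f : Multiset S) = {a} + Multiset.replicate 1 x} = leafLine a L :=
    fun a L => Set.ext fun f => exists_congr fun y => and_congr_right fun _ =>
      ⟨fun h => Subtype.ext h, fun h => congrArg Subtype.val h⟩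
  have key' : ∀ L : Set S,
      {f : Sym S 2 | ∃ x ∈ L, (f : Multiset S) = 0 + Multiset.replicate 2 x} = doubleLine L :=
    fun L => Set.ext fun f => exists_congr fun y => and_congr_right fun _ =>
      ⟨fun h => Subtype.ext h, fun h => congrArg Subtype.val h⟩
  constructor
  · rintro ⟨r, hr, hr2, e, he, L, hL, rfl⟩
    obtain rfl | rfl : r = 1 ∨ r = 2 := by omega
    · obtain ⟨a, rfl⟩ := Multiset.card_eq_one.1 he
      exact ⟨L, hL, Or.inl ⟨a, key a L⟩⟩
    · obtain rfl := Multiset.card_eq_zero.1 he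
      exact ⟨L, hL, Or.inr (key' L)⟩
  · rintro ⟨L, hL, ⟨a, rfl⟩ | rfl⟩
    · exact ⟨1, one_pos, one_le_two, {a}, rfl, L, hL, (key a L).symm⟩
    · exact ⟨2, two_pos, le_rfl, 0, rfl, L, hL, (key' L).symm⟩

/-- The points `x` and `y` are far from each other: `x + y` is a point outside `H`. -/
def Far (H : Set (Sym S 2)) (x y : S) : Prop := pair x y ∉ H

theorem Far.symm {H : Set (Sym S 2)} {x y : S} (h : Far H x y) : Far H y x := by
  rwa [Far, pair_comm]

/-- Two points are collinear when they lie on a common line. -/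
def PointLineSpace.Collinear (W : PointLineSpace S) (x y : S) : Prop :=
  ∃ L ∈ W.lines, x ∈ L ∧ y ∈ L

theorem PointLineSpace.Collinear.symm {W : PointLineSpace S} {x y : S} (h : W.Collinear x y) :
    W.Collinear y x :=
  let ⟨L, hL, hx, hy⟩ := h
  ⟨L, hL, hy, hx⟩

/-- The properties of a polar space `W` and of a hyperplane `H` of its second Veronese space from
which the Veronese space is recovered in the affine reduct. -/
structure PolarPair (W : PointLineSpace S) (H : Set (Sym S 2)) : Prop where
  far_irrefl : ∀ x, ¬ Far H x x
  line_unique : ∀ L ∈ W.lines, ∀ M ∈ W.lines, ∀ x y, x ≠ y → x ∈ L → y ∈ L → x ∈ M → y ∈ M → L = M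
  /-- at most one point of a line is not far from `a`, unless none is far -/
  not_far_unique : ∀ L ∈ W.lines, ∀ a u v z, Far H a z → z ∈ L → u ∈ L → v ∈ L →
    ¬ Far H a u → ¬ Far H a v → u = v
  four_le : ∀ L ∈ W.lines, 4 ≤ L.encard
  exists_far : ∀ x, ∃ y, Far H x y
  exists_line : ∀ x, ∃ L ∈ W.lines, x ∈ L
  /-- the points far from `x` are connected by short paths -/
  exists_link : ∀ x, ∀ L ∈ W.lines, ∀ M ∈ W.lines, (∃ y ∈ L, Far H x y) → (∃ y ∈ M, Far H x y) →
    ∃ y ∈ L, ∃ z ∈ M, ∃ w, Far H x y ∧ Far H x z ∧ Far H x w ∧ W.Collinear y w ∧ W.Collinear w z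
  /-- either there are planes, and two lines through a point that span no plane are both coplanar
  with a third one, or there are no planes, and pairs of points have many common neighbours -/
  planes_or_no_planes :
    ((∀ L ∈ W.lines, ∀ y ∈ L, ∃ M ∈ W.lines, y ∈ M ∧ L ≠ M ∧ ∀ u ∈ L, ∀ v ∈ M, W.Collinear u v) ∧
      ∀ L ∈ W.lines, ∀ M ∈ W.lines, ∀ y ∈ L, y ∈ M → (∀ u ∈ L, ∀ v ∈ M, W.Collinear u v) ∨
        ∃ N ∈ W.lines, y ∈ N ∧ L ≠ N ∧ N ≠ M ∧ (∀ u ∈ L, ∀ v ∈ N, W.Collinear u v) ∧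
          ∀ u ∈ N, ∀ v ∈ M, W.Collinear u v) ∨
    ((∀ L ∈ W.lines, ∀ M ∈ W.lines, L ≠ M → ∀ y ∈ L, y ∈ M → ∀ u ∈ L, ∀ v ∈ M, u ≠ y → v ≠ y →
        ¬ W.Collinear u v) ∧
      ∀ x y u v, Far H x y → W.Collinear u y → W.Collinear v y → ¬ W.Collinear u v →
        ∃ w z, w ≠ y ∧ z ≠ y ∧ w ≠ z ∧ Far H x w ∧ Far H x z ∧ W.Collinear u w ∧
          W.Collinear v w ∧ W.Collinear u z ∧ W.Collinear v z)

/-- The universe of the affine reduct of the second Veronese space, as a first-order structure. -/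
abbrev ReductElem (W : PointLineSpace S) (H : Set (Sym S 2)) :=
  ((W.veronese 2).affineReduct H).Elem

variable {W : PointLineSpace S} {H : Set (Sym S 2)}

/-- `e` is the point `x + y` of the affine reduct. -/
def IsSum (e : ReductElem W H) (x y : S) : Prop :=
  ∃ h : pair x y ∉ H, e = Sum.inl ⟨pair x y, h⟩

/-- `l` is the line `a + L` of the affine reduct, so that some point of `L` is far from `a`. The
leaf of `a` consists of these lines; `L` is the axis of `l`. -/
def IsLeafLine (l : ReductElem W H) (a : S) (L : Set S) : Prop :=
  L ∈ W.lines ∧ (∃ x ∈ L, Far H a x) ∧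
    ∃ T : ((W.veronese 2).affineReduct H).lines, l = Sum.inr T ∧
      (T : Set {p : Sym S 2 // p ∉ H}) = Subtype.val ⁻¹' leafLine a L

theorem IsSum.far {e : ReductElem W H} {x y : S} (h : IsSum e x y) : Far H x y := h.1

theorem IsSum.symm {e : ReductElem W H} {x y : S} (h : IsSum e x y) : IsSum e y x := by
  obtain ⟨h, rfl⟩ := h
  exact ⟨Far.symm h, by congr 2; exact pair_comm _ _⟩

theorem Far.exists_isSum (W : PointLineSpace S) {x y : S} (h : Far H x y) :
    ∃ e : ReductElem W H, IsSum e x y :=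
  ⟨_, h, rfl⟩

theorem IsSum.unique {e e' : ReductElem W H} {x y : S} (h : IsSum e x y) (h' : IsSum e' x y) :
    e = e' := by
  obtain ⟨_, rfl⟩ := h
  obtain ⟨_, rfl⟩ := h'
  rfl

theorem IsSum.cases {e : ReductElem W H} {x y x' y' : S} (h : IsSum e x y) (h' : IsSum e x' y') :
    (x = x' ∧ y = y') ∨ (x = y' ∧ y = x') := by
  obtain ⟨_, rfl⟩ := h
  obtain ⟨_, h'⟩ := h'
  exact pair_eq_pair.1 (congrArg Subtype.val (Sum.inl_injective h'))

theorem IsSum.right_unique {e : ReductElem W H} {x y z : S} (h : IsSum e x y) (h' : IsSum e x z) :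
    y = z := by
  rcases h.cases h' with ⟨-, h⟩ | ⟨h, h'⟩
  · exact h
  · exact h'.trans h

theorem IsLeafLine.mem {l : ReductElem W H} {a : S} {L : Set S} (h : IsLeafLine l a L) :
    L ∈ W.lines := h.1

theorem exists_isLeafLine {a x : S} {L : Set S} (hL : L ∈ W.lines) (hx : x ∈ L) (h : Far H a x) :
    ∃ l : ReductElem W H, IsLeafLine l a L := by
  exact ⟨Sum.inr ⟨Subtype.val ⁻¹' leafLine a L, leafLine a L,
    mem_veronese_two_lines.2 ⟨L, hL, Or.inl ⟨a, rfl⟩⟩, fun hH => h (hH ⟨x, hx, rfl⟩), rfl⟩,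
    hL, ⟨x, hx, h⟩, _, rfl, rfl⟩

theorem IsLeafLine.eq {l l' : ReductElem W H} {a : S} {L : Set S} (h : IsLeafLine l a L)
    (h' : IsLeafLine l' a L) : l = l' := by
  obtain ⟨-, -, T, rfl, hT⟩ := h
  obtain ⟨-, -, T', rfl, hT'⟩ := h'
  exact congrArg Sum.inr (Subtype.ext (hT.trans hT'.symm))

theorem inc_iff {e l : ReductElem W H} {a : S} {L : Set S} (h : IsLeafLine l a L) :
    NamedFormula.Inc e l ↔ ∃ t ∈ L, IsSum e a t := by
  obtain ⟨-, -, T, rfl, hT⟩ := h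
  constructor
  · rintro ⟨p, T', h1, h2, h3⟩
    obtain rfl : T = T' := Sum.inr_injective h2
    rw [hT] at h3
    obtain ⟨t, ht, hp⟩ := h3
    refine ⟨t, ht, hp ▸ p.2, ?_⟩
    exact h1.trans (congrArg Sum.inl (Subtype.ext hp))
  · rintro ⟨t, ht, hf, rfl⟩
    exact ⟨_, T, rfl, rfl, by rw [hT]; exact ⟨t, ht, rfl⟩⟩

theorem IsSum.inc {e l : ReductElem W H} {a t : S} {L : Set S} (h : IsSum e a t)
    (hl : IsLeafLine l a L) (ht : t ∈ L) : NamedFormula.Inc e l :=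
  (inc_iff hl).2 ⟨t, ht, h⟩

end Reduct

open NamedFormula

/-! ### Points and lines of the reduct in terms of leaves -/

section Leaves

variable {S : Type*} {W : PointLineSpace S} {H : Set (Sym S 2)}

theorem PolarPair.ne (hP : PolarPair W H) {x y : S} (h : Far H x y) : x ≠ y := by
  rintro rfl
  exact hP.far_irrefl _ h

/-- Every line of the affine reduct is of the form `a + L`, as the lines `{2x : x ∈ L}` lie in the
hyperplane. -/
theorem PolarPair.isLine_iff (hP : PolarPair W H) {l : ReductElem W H} :
    IsLine Inc l ↔ ∃ a L, IsLeafLine l a L := by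
  constructor
  · rintro ⟨-, -, ⟨T, M, hM, hMH, rfl⟩, -, rfl, -⟩
    obtain ⟨L, hL, ⟨a, rfl⟩ | rfl⟩ := mem_veronese_two_lines.1 hM
    · refine ⟨a, L, hL, ?_, _, rfl, rfl⟩
      by_contra! hc
      refine hMH ?_
      rintro _ ⟨x, hx, rfl⟩
      exact not_not.1 (hc x hx)
    · refine (hMH ?_).elim
      rintro _ ⟨x, hx, rfl⟩
      exact not_not.1 (hP.far_irrefl x)
  · rintro ⟨a, L, h⟩
    obtain ⟨x, hx, hf⟩ := h.2.1
    obtain ⟨e, he⟩ := hf.exists_isSum W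
    exact ⟨e, he.inc h hx⟩

/-- A line that has a point far from `a` has three such points, hence a further one next to any two
given points. -/
theorem PolarPair.exists_far_ne (hP : PolarPair W H) {a x : S} {L : Set S} (hL : L ∈ W.lines)
    (hx : x ∈ L) (h : Far H a x) (y z : S) : ∃ t ∈ L, Far H a t ∧ t ≠ y ∧ t ≠ z := by
  by_contra! hc
  have h4 := hP.four_le L hL
  have : ∃ b, L ⊆ {y, z, b} := by
    by_cases hb : ∃ b ∈ L, ¬ Far H a b
    · obtain ⟨b, hb, hb'⟩ := hb
      refine ⟨b, fun t ht => ?_⟩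
      by_cases hf : Far H a t
      · by_cases h1 : t = y
        · simp [h1]
        · simp [hc t ht hf h1]
      · simp [hP.not_far_unique L hL a t b x h hx ht hb hf hb']
    · push Not at hb
      refine ⟨y, fun t ht => ?_⟩
      by_cases h1 : t = y
      · simp [h1]
      · simp [hc t ht (hb t ht) h1]
  obtain ⟨b, hb⟩ := this
  have h3 : ({y, z, b} : Set S).encard ≤ 3 := by
    calc _ ≤ ({b} : Set S).encard + 1 + 1 :=
          (Set.encard_insert_le _ _).trans (by gcongr; exact Set.encard_insert_le _ _)
      _ = 3 := by rw [Set.encard_singleton]; norm_num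
  have := h4.trans ((Set.encard_le_encard hb).trans h3)
  norm_num at this

theorem PolarPair.isLeafLine_unique (hP : PolarPair W H) {l : ReductElem W H} {a b : S}
    {L M : Set S} (h : IsLeafLine l a L) (h' : IsLeafLine l b M) : a = b ∧ L = M := by
  obtain ⟨x, hx, hax⟩ := h.2.1
  obtain ⟨y, hy, hay, hyx, -⟩ := hP.exists_far_ne h.mem hx hax x x
  obtain ⟨z, hz, haz, hzx, hzy⟩ := hP.exists_far_ne h.mem hx hax x y
  have key : ∀ t ∈ L, Far H a t → (a = b ∧ t ∈ M) ∨ t = b := fun t ht hat => by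
    obtain ⟨e, he⟩ := hat.exists_isSum W
    obtain ⟨s, hs, hes⟩ := (inc_iff h').1 (he.inc h ht)
    rcases he.cases hes with ⟨h1, rfl⟩ | ⟨-, h1⟩
    · exact Or.inl ⟨h1, hs⟩
    · exact Or.inr h1
  have hab : a = b := by
    rcases key x hx hax with h1 | h1
    · exact h1.1
    rcases key y hy hay with h2 | h2
    · exact h2.1
    exact (hyx (h2.trans h1.symm)).elim
  subst hab
  have key' : ∀ t ∈ L, Far H a t → t ∈ M := fun t ht hat =>
    (key t ht hat).elim (fun h => h.2) fun h => (hP.ne hat h.symm).elim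
  exact ⟨rfl, hP.line_unique L h.mem M h'.mem x y hyx.symm hx hy (key' x hx hax) (key' y hy hay)⟩

theorem PolarPair.joined_iff (hP : PolarPair W H) {e f : ReductElem W H} :
    Joined Inc e f ↔ ∃ a s t, W.Collinear s t ∧ IsSum e a s ∧ IsSum f a t := by
  constructor
  · rintro ⟨l, he, hf⟩
    obtain ⟨a, L, hl⟩ := hP.isLine_iff.1 ⟨e, he⟩
    obtain ⟨s, hs, has⟩ := (inc_iff hl).1 he
    obtain ⟨t, ht, hat⟩ := (inc_iff hl).1 hf
    exact ⟨a, s, t, ⟨L, hl.mem, hs, ht⟩, has, hat⟩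
  · rintro ⟨a, s, t, ⟨L, hL, hs, ht⟩, he, hf⟩
    obtain ⟨l, hl⟩ := exists_isLeafLine (W := W) hL hs he.far
    exact ⟨l, he.inc hl hs, hf.inc hl ht⟩

/-- `x + u` and `x + v` are joined only inside the leaf of `x`. -/
theorem PolarPair.joined_same (hP : PolarPair W H) {e f : ReductElem W H} {x u v : S}
    (he : IsSum e x u) (hf : IsSum f x v) (huv : u ≠ v) (h : Joined Inc e f) :
    W.Collinear u v := by
  obtain ⟨a, s, t, hst, hes, hft⟩ := hP.joined_iff.1 h
  have h1 := hP.ne he.far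
  have h2 := hP.ne hf.far
  rcases he.cases hes with ⟨rfl, rfl⟩ | ⟨rfl, rfl⟩ <;> rcases hf.cases hft with ⟨h3, h4⟩ | ⟨h3, h4⟩
  · exact h4 ▸ hst
  all_goals grind

/-- For four different points, `x + u` and `y + v` are not joined. -/
theorem PolarPair.eq_of_joined (hP : PolarPair W H) {e f : ReductElem W H} {x u y v : S}
    (he : IsSum e x u) (hf : IsSum f y v) (hxy : x ≠ y) (huy : u ≠ y) (hxv : x ≠ v)
    (h : Joined Inc e f) : u = v := by
  obtain ⟨a, s, t, hst, hes, hft⟩ := hP.joined_iff.1 h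
  rcases he.cases hes with ⟨rfl, rfl⟩ | ⟨rfl, rfl⟩ <;> rcases hf.cases hft with ⟨h3, h4⟩ | ⟨h3, h4⟩
    <;> grind

/-- Planarity is only possible inside a leaf: distinct lines `x + L` and `y + M` through `x + y`
contain only the joined pairs `x + u`, `y + u`, apart from those with the point `x + y`. -/
theorem PolarPair.eq_of_planarAt (hP : PolarPair W H) {p l m : ReductElem W H} {x y : S}
    {L M : Set S} (hl : IsLeafLine l x L) (hm : IsLeafLine m y M) (h : PlanarAt Inc p l m) :
    x = y := by
  by_contra hxy
  obtain ⟨-, hpl, hpm, a, b, c, hap, hbp, hcp, hbc, hal, hbm, hcm, hab, hac⟩ := h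
  obtain ⟨t, -, hp⟩ := (inc_iff hl).1 hpl
  obtain ⟨t', -, hp'⟩ := (inc_iff hm).1 hpm
  obtain ⟨u, -, ha⟩ := (inc_iff hl).1 hal
  obtain ⟨v, -, hb⟩ := (inc_iff hm).1 hbm
  obtain ⟨w, -, hc⟩ := (inc_iff hm).1 hcm
  have hp : IsSum p x y := by
    rcases hp.cases hp' with ⟨h, -⟩ | ⟨-, rfl⟩
    · exact (hxy h).elim
    · exact hp
  have huy : u ≠ y := by rintro rfl; exact hap (ha.unique hp)
  have hxv : x ≠ v := by rintro rfl; exact hbp (hb.unique hp.symm)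
  have hxw : x ≠ w := by rintro rfl; exact hcp (hc.unique hp.symm)
  have h1 := hP.eq_of_joined ha hb hxy huy hxv hab
  have h2 := hP.eq_of_joined ha hc hxy huy hxw hac
  subst h1; subst h2
  exact hbc (hb.unique hc)

theorem PolarPair.planarAt_of_collinear (hP : PolarPair W H) {p l m : ReductElem W H} {x y : S}
    {L M : Set S} (hl : IsLeafLine l x L) (hm : IsLeafLine m x M) (hp : IsSum p x y)
    (hyL : y ∈ L) (hyM : y ∈ M) (hLM : L ≠ M) (h : ∀ u ∈ L, ∀ v ∈ M, W.Collinear u v) :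
    PlanarAt Inc p l m := by
  obtain ⟨u, hu, hxu, huy, -⟩ := hP.exists_far_ne hl.mem hyL hp.far y y
  obtain ⟨v, hv, hxv, hvy, -⟩ := hP.exists_far_ne hm.mem hyM hp.far y y
  obtain ⟨w, hw, hxw, hwy, hwv⟩ := hP.exists_far_ne hm.mem hyM hp.far y v
  obtain ⟨a, ha⟩ := hxu.exists_isSum W
  obtain ⟨b, hb⟩ := hxv.exists_isSum W
  obtain ⟨c, hc⟩ := hxw.exists_isSum W
  refine ⟨fun h => hLM (hP.isLeafLine_unique hl (h ▸ hm)).2, hp.inc hl hyL, hp.inc hm hyM, a, b, c,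
    ?_, ?_, ?_, ?_, ha.inc hl hu, hb.inc hm hv, hc.inc hm hw,
    hP.joined_iff.2 ⟨x, u, v, h u hu v hv, ha, hb⟩, hP.joined_iff.2 ⟨x, u, w, h u hu w hw, ha, hc⟩⟩
  · rintro rfl; exact huy (ha.right_unique hp)
  · rintro rfl; exact hvy (hb.right_unique hp)
  · rintro rfl; exact hwy (hc.right_unique hp)
  · rintro rfl; exact hwv (hc.right_unique hb)

end Leaves

/-! ### Lines of one leaf -/

section Local

variable {S : Type*} {W : PointLineSpace S} {H : Set (Sym S 2)}

/-- The point common to lines of different leaves is the sum of the points of these leaves. -/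
theorem isSum_of_ne {p l m : ReductElem W H} {x y : S} {L M : Set S} (hl : IsLeafLine l x L)
    (hm : IsLeafLine m y M) (hpl : Inc p l) (hpm : Inc p m) (hxy : x ≠ y) :
    IsSum p x y ∧ y ∈ L ∧ x ∈ M := by
  obtain ⟨t, ht, hp⟩ := (inc_iff hl).1 hpl
  obtain ⟨t', ht', hp'⟩ := (inc_iff hm).1 hpm
  rcases hp.cases hp' with ⟨h, -⟩ | ⟨rfl, rfl⟩
  · exact (hxy h).elim
  · exact ⟨hp, ht, ht'⟩

/-- The absence of planes: points of distinct lines through `y`, both different from `y`, are not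
collinear. -/
def NoPlanes (W : PointLineSpace S) : Prop :=
  ∀ L ∈ W.lines, ∀ M ∈ W.lines, L ≠ M → ∀ y ∈ L, y ∈ M → ∀ u ∈ L, ∀ v ∈ M, u ≠ y → v ≠ y →
    ¬ W.Collinear u v

/-- In a space without planes a point off a line is collinear with at most one point of it. -/
theorem NoPlanes.mem_of_collinear (h : NoPlanes W) {u v w : S} {M : Set S} (hM : M ∈ W.lines)
    (hv : v ∈ M) (hw : w ∈ M) (hvw : v ≠ w) (huv : W.Collinear u v) (huw : W.Collinear u w) :
    u ∈ M := by
  obtain ⟨K, hK, hu, hvK⟩ := huv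
  by_contra hc
  exact h K hK M hM (by rintro rfl; exact hc hu) v hvK hv u hu w hw
    (by rintro rfl; exact hc hv) hvw.symm huw

/-- Lines `x + L` and `y + M` of different leaves contain points `x + u`, `y + v` with `u` and `v`
not collinear, unless `L = M`. Their common neighbours are among `x + y` and `u + v`. -/
theorem PolarPair.crossAt_of_ne (hP : PolarPair W H) (hB : NoPlanes W) {p l m : ReductElem W H}
    {x y : S} {L M : Set S} (hl : IsLeafLine l x L) (hm : IsLeafLine m y M) (hp : IsSum p x y)
    (hyL : y ∈ L) (hxM : x ∈ M) : CrossAt Inc p l m := by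
  have hxy := hP.ne hp.far
  by_cases hLM : L = M
  · subst hLM
    obtain ⟨u, hu, hxu, huy, hux⟩ := hP.exists_far_ne hl.mem hyL hp.far y x
    have hyu : Far H y u := by
      by_contra hc
      exact huy (hP.not_far_unique L hl.mem y u y x hp.far.symm hxM hu hyL hc (hP.far_irrefl y))
    obtain ⟨a, ha⟩ := hxu.exists_isSum W
    obtain ⟨b, hb⟩ := hyu.exists_isSum W
    refine ⟨a, b, ?_, ?_, ha.inc hl hu, hb.inc hm hu, Or.inl (hP.joined_iff.2
      ⟨u, x, y, ⟨L, hl.mem, hxM, hyL⟩, ha.symm, hb.symm⟩)⟩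
    · rintro rfl; exact huy (ha.right_unique hp)
    · rintro rfl; exact hux (hb.right_unique hp.symm)
  obtain ⟨u, hu, v, hv, hxu, hyv, huy, hvx, huv⟩ : ∃ u ∈ L, ∃ v ∈ M, Far H x u ∧ Far H y v ∧
      u ≠ y ∧ v ≠ x ∧ ¬ W.Collinear u v := by
    obtain ⟨u, hu, hxu, huy, -⟩ := hP.exists_far_ne hl.mem hyL hp.far y y
    obtain ⟨u', hu', hxu', huy', huu'⟩ := hP.exists_far_ne hl.mem hyL hp.far y u
    obtain ⟨v, hv, hyv, hvx, -⟩ := hP.exists_far_ne hm.mem hxM hp.far.symm x x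
    obtain ⟨v', hv', hyv', hvx', hvv'⟩ := hP.exists_far_ne hm.mem hxM hp.far.symm x v
    by_contra! hc
    have h1 := hB.mem_of_collinear hm.mem hv hv' hvv'.symm (hc u hu v hv hxu hyv huy hvx)
      (hc u hu v' hv' hxu hyv' huy hvx')
    have h2 := hB.mem_of_collinear hm.mem hv hv' hvv'.symm (hc u' hu' v hv hxu' hyv huy' hvx)
      (hc u' hu' v' hv' hxu' hyv' huy' hvx')
    exact hLM (hP.line_unique L hl.mem M hm.mem u' u huu' hu' hu h2 h1)
  have huv' : u ≠ v := by
    rintro rfl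
    exact huv ⟨L, hl.mem, hu, hu⟩
  obtain ⟨a, ha⟩ := hxu.exists_isSum W
  obtain ⟨b, hb⟩ := hyv.exists_isSum W
  refine ⟨a, b, ?_, ?_, ha.inc hl hu, hb.inc hm hv, Or.inr ?_⟩
  · rintro rfl; exact huy (ha.right_unique hp)
  · rintro rfl; exact hvx (hb.right_unique hp.symm)
  have key : ∀ c, Joined Inc a c → Joined Inc b c → IsSum c x y ∨ IsSum c u v := by
    intro c hac hbc
    obtain ⟨d, s, t, hst, has, hct⟩ := hP.joined_iff.1 hac
    obtain ⟨d', s', t', hst', hbs, hct'⟩ := hP.joined_iff.1 hbc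
    rcases ha.cases has with ⟨rfl, rfl⟩ | ⟨rfl, rfl⟩ <;>
      rcases hb.cases hbs with ⟨rfl, rfl⟩ | ⟨rfl, rfl⟩ <;>
      rcases hct.cases hct' with ⟨h1, h2⟩ | ⟨h1, h2⟩ <;> subst h1 <;> try subst h2
    all_goals first
      | exact Or.inl hct
      | exact Or.inr hct
      | exact absurd rfl hxy
      | exact absurd rfl huv'
      | exact absurd rfl huy
      | exact absurd rfl hvx
      | exact absurd hst huv
      | exact absurd hst'.symm huv
  rintro ⟨c, d, e, hcd, hce, hde, hac, hbc, had, hbd, hae, hbe⟩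
  rcases key c hac hbc with h1 | h1 <;> rcases key d had hbd with h2 | h2 <;>
    rcases key e hae hbe with h3 | h3
  all_goals first
    | exact hcd (h1.unique h2)
    | exact hce (h1.unique h3)
    | exact hde (h2.unique h3)

/-- For `u` and `v` not collinear, all `x + w` with `w` collinear with both are common neighbours
of `x + u` and `x + v`. -/
theorem PolarPair.not_crossAt (hP : PolarPair W H) (hB : NoPlanes W)
    (hB' : ∀ x y u v, Far H x y → W.Collinear u y → W.Collinear v y → ¬ W.Collinear u v →
        ∃ w z, w ≠ y ∧ z ≠ y ∧ w ≠ z ∧ Far H x w ∧ Far H x z ∧ W.Collinear u w ∧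
          W.Collinear v w ∧ W.Collinear u z ∧ W.Collinear v z)
    {p l m : ReductElem W H} {x y : S} {L M : Set S} (hl : IsLeafLine l x L)
    (hm : IsLeafLine m x M) (hp : IsSum p x y) (hyL : y ∈ L) (hyM : y ∈ M) (hLM : L ≠ M) :
    ¬ CrossAt Inc p l m := by
  rintro ⟨a, b, hap, hbp, hal, hbm, h⟩
  obtain ⟨u, hu, ha⟩ := (inc_iff hl).1 hal
  obtain ⟨v, hv, hb⟩ := (inc_iff hm).1 hbm
  have huy : u ≠ y := by rintro rfl; exact hap (ha.unique hp)
  have hvy : v ≠ y := by rintro rfl; exact hbp (hb.unique hp)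
  have huv := hB L hl.mem M hm.mem hLM y hyL hyM u hu v hv huy hvy
  rcases h with h | h
  · refine huv (hP.joined_same ha hb ?_ h)
    rintro rfl
    exact huv ⟨L, hl.mem, hu, hu⟩
  · obtain ⟨w, z, hwy, hzy, hwz, hxw, hxz, h1, h2, h3, h4⟩ := hB' x y u v hp.far
      ⟨L, hl.mem, hu, hyL⟩ ⟨M, hm.mem, hv, hyM⟩ huv
    obtain ⟨c, hc⟩ := hxw.exists_isSum W
    obtain ⟨d, hd⟩ := hxz.exists_isSum W
    refine h ⟨p, c, d, ?_, ?_, ?_, hP.joined_iff.2 ⟨x, u, y, ⟨L, hl.mem, hu, hyL⟩, ha, hp⟩,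
      hP.joined_iff.2 ⟨x, v, y, ⟨M, hm.mem, hv, hyM⟩, hb, hp⟩, hP.joined_iff.2 ⟨x, u, w, h1, ha, hc⟩,
      hP.joined_iff.2 ⟨x, v, w, h2, hb, hc⟩, hP.joined_iff.2 ⟨x, u, z, h3, ha, hd⟩,
      hP.joined_iff.2 ⟨x, v, z, h4, hb, hd⟩⟩
    · rintro rfl; exact hwy (hc.right_unique hp)
    · rintro rfl; exact hzy (hd.right_unique hp)
    · rintro rfl; exact hwz (hc.right_unique hd)

theorem PolarPair.not_planarAt (hP : PolarPair W H) (hB : NoPlanes W) {p l n : ReductElem W H} :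
    ¬ PlanarAt Inc p l n := by
  intro h
  obtain ⟨x, L, hl⟩ := hP.isLine_iff.1 ⟨p, h.2.1⟩
  obtain ⟨z, N, hn⟩ := hP.isLine_iff.1 ⟨p, h.2.2.1⟩
  obtain rfl := hP.eq_of_planarAt hl hn h
  obtain ⟨hln, hpl, hpn, a, b, -, hap, hbp, -, -, hal, hbn, -, hab, -⟩ := h
  have hLN : L ≠ N := by rintro rfl; exact hln (hl.eq hn)
  obtain ⟨y, hy, hp⟩ := (inc_iff hl).1 hpl
  obtain ⟨y', hy', hp'⟩ := (inc_iff hn).1 hpn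
  obtain rfl := hp.right_unique hp'
  obtain ⟨u, hu, ha⟩ := (inc_iff hl).1 hal
  obtain ⟨v, hv, hb⟩ := (inc_iff hn).1 hbn
  have huy : u ≠ y := by rintro rfl; exact hap (ha.unique hp)
  have hvy : v ≠ y := by rintro rfl; exact hbp (hb.unique hp)
  have huv := hB L hl.mem N hn.mem hLN y hy hy' u hu v hv huy hvy
  refine huv (hP.joined_same ha hb ?_ hab)
  rintro rfl
  exact huv ⟨L, hl.mem, hu, hu⟩

theorem PolarPair.sameLeafAt_iff (hP : PolarPair W H) {p l m : ReductElem W H} {x y : S}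
    {L M : Set S} (hl : IsLeafLine l x L) (hm : IsLeafLine m y M) :
    SameLeafAt Inc p l m ↔ Inc p l ∧ Inc p m ∧ x = y := by
  constructor
  · rintro ⟨hpl, hpm, h⟩
    refine ⟨hpl, hpm, ?_⟩
    rcases h with h | h | ⟨n, h, h'⟩ | ⟨h, h'⟩
    · exact (hP.isLeafLine_unique hl (h ▸ hm)).1
    · exact hP.eq_of_planarAt hl hm h
    · obtain ⟨z, N, hn⟩ := hP.isLine_iff.1 ⟨p, h.2.2.1⟩
      exact (hP.eq_of_planarAt hl hn h).trans (hP.eq_of_planarAt hn hm h')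
    · by_contra hxy
      obtain ⟨hp, hyL, hxM⟩ := isSum_of_ne hl hm hpl hpm hxy
      rcases hP.planes_or_no_planes with ⟨hA, -⟩ | ⟨hB, -⟩
      · obtain ⟨N, hN, hyN, hLN, hc⟩ := hA L hl.mem y hyL
        obtain ⟨n, hn⟩ := exists_isLeafLine (W := W) hN hyN hp.far
        exact h ⟨n, hP.planarAt_of_collinear hl hn hp hyL hyN hLN hc⟩
      · exact h' (hP.crossAt_of_ne hB hl hm hp hyL hxM)
  · rintro ⟨hpl, hpm, rfl⟩
    refine ⟨hpl, hpm, ?_⟩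
    by_cases hLM : L = M
    · subst hLM
      exact Or.inl (hl.eq hm)
    obtain ⟨y, hyL, hp⟩ := (inc_iff hl).1 hpl
    obtain ⟨y', hyM, hp'⟩ := (inc_iff hm).1 hpm
    obtain rfl := hp.right_unique hp'
    rcases hP.planes_or_no_planes with ⟨-, hA⟩ | ⟨hB, hB'⟩
    · rcases hA L hl.mem M hm.mem y hyL hyM with h | ⟨N, hN, hyN, hLN, hNM, h, h'⟩
      · exact Or.inr (Or.inl (hP.planarAt_of_collinear hl hm hp hyL hyM hLM h))
      · obtain ⟨n, hn⟩ := exists_isLeafLine (W := W) hN hyN hp.far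
        exact Or.inr (Or.inr (Or.inl ⟨n, hP.planarAt_of_collinear hl hn hp hyL hyN hLN h,
          hP.planarAt_of_collinear hn hm hp hyN hyM hNM h'⟩))
    · exact Or.inr (Or.inr (Or.inr ⟨fun ⟨n, hn⟩ => hP.not_planarAt hB hn,
        hP.not_crossAt hB hB' hl hm hp hyL hyM hLM⟩))

theorem PolarPair.sameLeaf_iff (hP : PolarPair W H) {l m : ReductElem W H} {x y : S}
    {L M : Set S} (hl : IsLeafLine l x L) (hm : IsLeafLine m y M) :
    SameLeaf Inc l m ↔ x = y := by
  constructor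
  · rintro ⟨n, k, p, q, r, h1, h2, h3⟩
    obtain ⟨a, N, hn⟩ := hP.isLine_iff.1 ⟨p, h1.2.1⟩
    obtain ⟨b, K, hk⟩ := hP.isLine_iff.1 ⟨q, h2.2.1⟩
    exact ((hP.sameLeafAt_iff hl hn).1 h1).2.2.trans (((hP.sameLeafAt_iff hn hk).1 h2).2.2.trans
      ((hP.sameLeafAt_iff hk hm).1 h3).2.2)
  · rintro rfl
    obtain ⟨y, hy, z, hz, w, hxy, hxz, hxw, ⟨K, hK, hyK, hwK⟩, ⟨N, hN, hwN, hzN⟩⟩ :=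
      hP.exists_link x L hl.mem M hm.mem hl.2.1 hm.2.1
    obtain ⟨k, hk⟩ := exists_isLeafLine (W := W) hK hyK hxy
    obtain ⟨n, hn⟩ := exists_isLeafLine (W := W) hN hzN hxz
    obtain ⟨p, hp⟩ := hxy.exists_isSum W
    obtain ⟨q, hq⟩ := hxw.exists_isSum W
    obtain ⟨r, hr⟩ := hxz.exists_isSum W
    exact ⟨k, n, p, q, r, (hP.sameLeafAt_iff hl hk).2 ⟨hp.inc hl hy, hp.inc hk hyK, rfl⟩,
      (hP.sameLeafAt_iff hk hn).2 ⟨hq.inc hk hwK, hq.inc hn hwN, rfl⟩,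
      (hP.sameLeafAt_iff hn hm).2 ⟨hr.inc hn hzN, hr.inc hm hz, rfl⟩⟩

theorem SameLeaf.isLine {E : Type*} {I : E → E → Prop} {l m : E} (h : SameLeaf I l m) :
    IsLine I l ∧ IsLine I m :=
  let ⟨_, _, p, _, r, h1, _, h3⟩ := h
  ⟨⟨p, h1.1⟩, ⟨r, h3.2.1⟩⟩

end Local

/-! ### Recovery of the Veronese space -/

section Recovery

variable {S : Type*} {W : PointLineSpace S} {H : Set (Sym S 2)}

theorem PolarPair.exists_leafLine_of_point (hP : PolarPair W H) (x : S) :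
    ∃ (l : ReductElem W H) (L : Set S), IsLeafLine l x L := by
  obtain ⟨y, hxy⟩ := hP.exists_far x
  obtain ⟨L, hL, hy⟩ := hP.exists_line y
  obtain ⟨l, hl⟩ := exists_isLeafLine (W := W) hL hy hxy
  exact ⟨l, L, hl⟩

theorem PolarPair.nontrivial (hP : PolarPair W H) {L : Set S} (hL : L ∈ W.lines) :
    L.Nontrivial :=
  Set.one_lt_encard_iff_nontrivial.1 (lt_of_lt_of_le (by norm_num) (hP.four_le L hL))

theorem PolarPair.onAffine_iff (hP : PolarPair W H) {k l : ReductElem W H} {x a : S}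
    {K L : Set S} (hk : IsLeafLine k x K) (hl : IsLeafLine l a L) :
    OnAffine Inc k l ↔ x ∈ L ∧ Far H a x := by
  rw [OnAffine, hP.sameLeaf_iff hk hl]
  constructor
  · rintro ⟨hxa, p, m, hpl, hpm, h⟩
    obtain ⟨b, M, hm⟩ := hP.isLine_iff.1 ⟨p, hpm⟩
    obtain rfl := (hP.sameLeaf_iff hm hk).1 h
    obtain ⟨hp, hx, -⟩ := isSum_of_ne hl hm hpl hpm (Ne.symm hxa)
    exact ⟨hx, hp.far⟩
  · rintro ⟨hx, hax⟩
    obtain ⟨p, hp⟩ := hax.exists_isSum W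
    obtain ⟨M, hM, ha⟩ := hP.exists_line a
    obtain ⟨m, hm⟩ := exists_isLeafLine (W := W) hM ha hax.symm
    exact ⟨(hP.ne hax).symm, p, m, hp.inc hl hx, hp.symm.inc hm ha, (hP.sameLeaf_iff hm hk).2 rfl⟩

theorem OnAffine.isLine {E : Type*} {I : E → E → Prop} {k l : E} (h : OnAffine I k l) :
    IsLine I k ∧ IsLine I l :=
  let ⟨_, p, _, hpl, _, h⟩ := h
  ⟨h.isLine.2, p, hpl⟩

theorem PolarPair.sameAxis_iff (hP : PolarPair W H) {l m : ReductElem W H} {a b : S}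
    {L M : Set S} (hl : IsLeafLine l a L) (hm : IsLeafLine m b M) :
    SameAxis Inc l m ↔ L = M := by
  constructor
  · rintro ⟨k, n, hkn, h1, h2, h3, h4⟩
    obtain ⟨x, K, hk⟩ := hP.isLine_iff.1 h1.isLine.1
    obtain ⟨y, N, hn⟩ := hP.isLine_iff.1 h3.isLine.1
    exact hP.line_unique L hl.mem M hm.mem x y (fun h => hkn ((hP.sameLeaf_iff hk hn).2 h))
      ((hP.onAffine_iff hk hl).1 h1).1 ((hP.onAffine_iff hn hl).1 h3).1
      ((hP.onAffine_iff hk hm).1 h2).1 ((hP.onAffine_iff hn hm).1 h4).1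
  · rintro rfl
    obtain ⟨s, hs, has⟩ := hl.2.1
    obtain ⟨t, ht, hbt⟩ := hm.2.1
    -- `c` is the exceptional point of `L` that is not far from `b`, if there is one
    obtain ⟨c, hc⟩ : ∃ c, ∀ x ∈ L, x ≠ c → Far H b x := by
      by_cases h : ∃ c ∈ L, ¬ Far H b c
      · obtain ⟨c, hc, hbc⟩ := h
        refine ⟨c, fun x hx hxc => ?_⟩
        by_contra hbx
        exact hxc (hP.not_far_unique L hl.mem b x c t hbt ht hx hc hbx hbc)
      · push Not at h
        exact ⟨s, fun x hx _ => h x hx⟩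
    obtain ⟨x, hx, hax, hxc, -⟩ := hP.exists_far_ne hl.mem hs has c c
    obtain ⟨y, hy, hay, hyc, hyx⟩ := hP.exists_far_ne hl.mem hs has c x
    obtain ⟨k, K, hk⟩ := hP.exists_leafLine_of_point x
    obtain ⟨n, N, hn⟩ := hP.exists_leafLine_of_point y
    exact ⟨k, n, fun h => hyx ((hP.sameLeaf_iff hk hn).1 h).symm,
      (hP.onAffine_iff hk hl).2 ⟨hx, hax⟩, (hP.onAffine_iff hk hm).2 ⟨hx, hc x hx hxc⟩,
      (hP.onAffine_iff hn hl).2 ⟨hy, hay⟩, (hP.onAffine_iff hn hm).2 ⟨hy, hc y hy hyc⟩⟩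

theorem PolarPair.onAxis_iff (hP : PolarPair W H) {k l : ReductElem W H} {x a : S}
    {K L : Set S} (hk : IsLeafLine k x K) (hl : IsLeafLine l a L) :
    OnAxis Inc k l ↔ x ∈ L := by
  constructor
  · rintro ⟨m, h, h'⟩
    obtain ⟨b, M, hm⟩ := hP.isLine_iff.1 h'.isLine.2
    obtain rfl := (hP.sameAxis_iff hm hl).1 h
    exact ((hP.onAffine_iff hk hm).1 h').1
  · intro hx
    obtain ⟨b, hxb⟩ := hP.exists_far x
    obtain ⟨m, hm⟩ := exists_isLeafLine (W := W) hl.mem hx hxb.symm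
    exact ⟨m, (hP.sameAxis_iff hm hl).2 rfl, (hP.onAffine_iff hk hm).2 ⟨hx, hxb.symm⟩⟩

theorem PolarPair.leafLine_inj (hP : PolarPair W H) {a b : S} {L M : Set S} (hL : L ∈ W.lines) :
    leafLine a L = leafLine b M ↔ a = b ∧ L = M := by
  constructor
  · intro h
    obtain ⟨x, hx, y, hy, hxy⟩ := hP.nontrivial hL
    have key : ∀ z ∈ L, a = b ∨ z = b := by
      intro z hz
      obtain ⟨s, -, hs⟩ : pair a z ∈ leafLine b M := h ▸ ⟨z, hz, rfl⟩
      rcases pair_eq_pair.1 hs with h | h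
      · exact Or.inl h.1
      · exact Or.inr h.2
    have hab : a = b := by
      rcases key x hx with h | h
      · exact h
      rcases key y hy with h' | h'
      · exact h'
      exact (hxy (h.trans h'.symm)).elim
    subst hab
    have sub : ∀ L M : Set S, leafLine a L = leafLine a M → L ⊆ M := by
      intro L M h z hz
      obtain ⟨s, hs, hs'⟩ : pair a z ∈ leafLine a M := h ▸ ⟨z, hz, rfl⟩
      rcases pair_eq_pair.1 hs' with ⟨-, rfl⟩ | ⟨rfl, rfl⟩
      · exact hs
      · exact hs
    exact ⟨rfl, (sub L M h).antisymm (sub M L h.symm)⟩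
  · rintro ⟨rfl, rfl⟩
    rfl

theorem pair_self_mem_doubleLine {x : S} {L : Set S} : pair x x ∈ doubleLine L ↔ x ∈ L := by
  constructor
  · rintro ⟨s, hs, h⟩
    rcases pair_eq_pair.1 h with ⟨rfl, -⟩ | ⟨rfl, -⟩ <;> exact hs
  · exact fun h => ⟨x, h, rfl⟩

theorem doubleLine_inj {L M : Set S} : doubleLine L = doubleLine M ↔ L = M :=
  ⟨fun h => Set.ext fun x => by
    rw [← pair_self_mem_doubleLine, h, pair_self_mem_doubleLine], fun h => h ▸ rfl⟩

theorem PolarPair.leafLine_ne_doubleLine (hP : PolarPair W H) {a : S} {L M : Set S}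
    (hL : L ∈ W.lines) : leafLine a L ≠ doubleLine M := by
  intro h
  obtain ⟨x, hx, hxa⟩ := (hP.nontrivial hL).exists_ne a
  obtain ⟨s, -, hs⟩ : pair a x ∈ doubleLine M := h ▸ ⟨x, hx, rfl⟩
  rcases pair_eq_pair.1 hs with h | h <;> exact hxa (h.2.trans h.1.symm)

theorem pair_mem_leafLine {x y a : S} {L : Set S} :
    pair x y ∈ leafLine a L ↔ (x = a ∧ y ∈ L) ∨ (y = a ∧ x ∈ L) := by
  constructor
  · rintro ⟨s, hs, h⟩
    rcases pair_eq_pair.1 h with ⟨rfl, rfl⟩ | ⟨rfl, rfl⟩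
    · exact Or.inl ⟨rfl, hs⟩
    · exact Or.inr ⟨rfl, hs⟩
  · rintro (⟨rfl, h⟩ | ⟨rfl, h⟩)
    · exact ⟨y, h, rfl⟩
    · exact ⟨x, h, pair_comm x y⟩

theorem pair_mem_doubleLine {x y : S} {L : Set S} :
    pair x y ∈ doubleLine L ↔ x = y ∧ x ∈ L := by
  constructor
  · rintro ⟨s, hs, h⟩
    rcases pair_eq_pair.1 h with ⟨rfl, rfl⟩ | ⟨rfl, rfl⟩ <;> exact ⟨rfl, hs⟩
  · rintro ⟨rfl, h⟩
    exact ⟨x, h, rfl⟩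

theorem not_isLine_ofPoint (e : ReductElem W H) (p : {p : Sym S 2 // p ∉ H})
    (h : e = Sum.inl p) : ¬ IsLine Inc e := by
  rintro ⟨_, _, T, _, h', _⟩
  exact Sum.inl_ne_inr (h.symm.trans h')

/-- The definition `veroneseDefinition` recovers the second Veronese space from its affine reduct:
a line `a + L` of the reduct stands for `a` as well as for `L`, and these codings are
first-order. -/
theorem PolarPair.defines (hP : PolarPair W H) :
    veroneseDefinition.Defines (W.veronese 2) H := by
  classical
  have ex : ∀ l : ReductElem W H, ∃ a L, IsLine Inc l → IsLeafLine l a L := by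
    intro l
    by_cases h : IsLine Inc l
    · obtain ⟨a, L, hl⟩ := hP.isLine_iff.1 h
      exact ⟨a, L, fun _ => hl⟩
    · rcases l with p | T
      · exact ⟨(exists_pair p.1).choose, ∅, fun h' => (h h').elim⟩
      · obtain ⟨M, hM, hMH, -⟩ := T.2
        obtain ⟨f, -, -⟩ := Set.not_subset.1 hMH
        exact ⟨(exists_pair f).choose, ∅, fun h' => (h h').elim⟩
  choose a L hl using ex
  have ha : ∀ {l : ReductElem W H} {b M}, IsLeafLine l b M → a l = b ∧ L l = M := fun h =>
    hP.isLeafLine_unique (hl _ (hP.isLine_iff.2 ⟨_, _, h⟩)) h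
  have leaf : ∀ {l m : ReductElem W H}, IsLine Inc l → IsLine Inc m →
      (SameLeaf Inc l m ↔ a l = a m) := fun h h' => hP.sameLeaf_iff (hl _ h) (hl _ h')
  have axis : ∀ {l m : ReductElem W H}, IsLine Inc l → IsLine Inc m →
      (SameAxis Inc l m ↔ L l = L m) := fun h h' => hP.sameAxis_iff (hl _ h) (hl _ h')
  have onax : ∀ {l m : ReductElem W H}, IsLine Inc l → IsLine Inc m →
      (OnAxis Inc l m ↔ a l ∈ L m) := fun h h' => hP.onAxis_iff (hl _ h) (hl _ h')
  refine ⟨fun x => pair (a (x.1 (0 : Fin 2))) (a (x.1 (1 : Fin 2))), fun y =>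
    ⟨if IsLine Inc (y.1 (2 : Fin 3)) then leafLine (a (y.1 (0 : Fin 3))) (L (y.1 (1 : Fin 3)))
      else doubleLine (L (y.1 (1 : Fin 3))), ?_⟩, ?_, ?_, ?_, ?_, ?_, ?_⟩
  · have hL := (hl _ ((realize_isLine _).1 y.2).2).mem
    split_ifs
    · exact mem_veronese_two_lines.2 ⟨_, hL, Or.inl ⟨_, rfl⟩⟩
    · exact mem_veronese_two_lines.2 ⟨_, hL, Or.inr rfl⟩
  · intro e
    obtain ⟨x, y, rfl⟩ := exists_pair e
    obtain ⟨l, _, hlx⟩ := hP.exists_leafLine_of_point x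
    obtain ⟨m, _, hmy⟩ := hP.exists_leafLine_of_point y
    refine ⟨⟨(![l, m] : Fin 2 → ReductElem W H), (realize_isPoint _).2
      ⟨hP.isLine_iff.2 ⟨_, _, hlx⟩, hP.isLine_iff.2 ⟨_, _, hmy⟩⟩⟩, ?_⟩
    exact congrArg₂ pair (ha hlx).1 (ha hmy).1
  · rintro ⟨T, hT⟩
    obtain ⟨M, hM, h⟩ := mem_veronese_two_lines.1 hT
    obtain ⟨x, hx⟩ := (hP.nontrivial hM).nonempty
    obtain ⟨b, hxb⟩ := hP.exists_far x
    obtain ⟨m, hm⟩ := exists_isLeafLine (W := W) hM hx hxb.symm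
    have hm' := hP.isLine_iff.2 ⟨_, _, hm⟩
    rcases h with ⟨c, rfl⟩ | rfl
    · obtain ⟨l, _, hlc⟩ := hP.exists_leafLine_of_point c
      have hl' := hP.isLine_iff.2 ⟨_, _, hlc⟩
      refine ⟨⟨(![l, m, l] : Fin 3 → ReductElem W H), (realize_isLine _).2 ⟨hl', hm'⟩⟩, ?_⟩
      exact Subtype.ext ((if_pos hl').trans (congrArg₂ leafLine (ha hlc).1 (ha hm).2))
    · obtain ⟨p, hp⟩ := hxb.exists_isSum W
      refine ⟨⟨(![m, m, p] : Fin 3 → ReductElem W H), (realize_isLine _).2 ⟨hm', hm'⟩⟩, ?_⟩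
      exact Subtype.ext ((if_neg (not_isLine_ofPoint p _ hp.2)).trans
        (congrArg doubleLine (ha hm).2))
  · intro x x'
    obtain ⟨h0, h1⟩ := (realize_isPoint _).1 x.2
    obtain ⟨h0', h1'⟩ := (realize_isPoint _).1 x'.2
    refine (realize_samePoint _ _).trans ?_
    rw [leaf h0 h0', leaf h1 h1', leaf h0 h1', leaf h1 h0', pair_eq_pair]
  · intro y y'
    obtain ⟨h0, h1⟩ := (realize_isLine _).1 y.2
    obtain ⟨h0', h1'⟩ := (realize_isLine _).1 y'.2
    refine (realize_sameLine _ _).trans ?_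
    rw [leaf h0 h0', axis h1 h1', Subtype.mk.injEq]
    have hL := (hl _ h1).mem
    have hL' := (hl _ h1').mem
    split_ifs with h2 h2' h2'
    · rw [hP.leafLine_inj hL]; tauto
    · simp only [h2, h2', hP.leafLine_ne_doubleLine hL]; tauto
    · simp only [h2, h2', (hP.leafLine_ne_doubleLine hL').symm]; tauto
    · rw [doubleLine_inj]; tauto
  · intro x y
    obtain ⟨h0, h1⟩ := (realize_isPoint _).1 x.2
    obtain ⟨k0, k1⟩ := (realize_isLine _).1 y.2
    refine (realize_incident _ _).trans ?_
    rw [leaf h0 k0, leaf h1 k0, leaf h0 h1, onax h0 k1, onax h1 k1]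
    dsimp only
    split_ifs with h2
    · rw [pair_mem_leafLine]; tauto
    · rw [pair_mem_doubleLine]; tauto
  · intro p x
    obtain ⟨h0, h1⟩ := (realize_isPoint _).1 x.2
    refine (realize_proper _ _).trans ?_
    rw [leaf h0 h1]
    constructor
    · rintro ⟨hne, l, m, hpl, hpm, h, h'⟩
      have hlL : IsLine Inc l := ⟨_, hpl⟩
      have hmL : IsLine Inc m := ⟨_, hpm⟩
      rw [leaf hlL h0] at h
      rw [leaf hmL h1] at h'
      rw [← h, ← h'] at hne
      obtain ⟨⟨hf, hp⟩, -, -⟩ := isSum_of_ne (hl l hlL) (hl m hmL) hpl hpm hne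
      exact (congrArg₂ pair h h').symm.trans (congrArg Subtype.val (Sum.inl_injective hp)).symm
    · intro hp
      have hf : Far H (a (x.1 (0 : Fin 2))) (a (x.1 (1 : Fin 2))) :=
        fun h => p.2 (hp ▸ h)
      have hsum : IsSum (W := W) (Sum.inl p) (a (x.1 (0 : Fin 2))) (a (x.1 (1 : Fin 2))) :=
        ⟨hf, congrArg Sum.inl (Subtype.ext hp.symm)⟩
      obtain ⟨K, hK, h1K⟩ := hP.exists_line (a (x.1 (1 : Fin 2)))
      obtain ⟨N, hN, h0N⟩ := hP.exists_line (a (x.1 (0 : Fin 2)))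
      obtain ⟨l, hlK⟩ := exists_isLeafLine (W := W) hK h1K hf
      obtain ⟨m, hmN⟩ := exists_isLeafLine (W := W) hN h0N hf.symm
      exact ⟨hP.ne hf, l, m, hsum.inc hlK h1K, hsum.symm.inc hmN h0N,
        (hP.sameLeaf_iff hlK (hl _ h0)).2 rfl, (hP.sameLeaf_iff hmN (hl _ h1)).2 rfl⟩

end Recovery

/-! ### Totally isotropic subspaces -/

section Forms

open Module

variable {F V : Type*} [Field F] [AddCommGroup V] [Module F V]

/-- A subspace on which the form vanishes. -/
def TotallyIsotropic (ξ : LinearMap.BilinForm F V) (U : Submodule F V) : Prop :=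
  ∀ u ∈ U, ∀ v ∈ U, ξ u v = 0

/-- A nondegenerate form that is alternating, or that is symmetric in characteristic different
from two and has a totally isotropic subspace of dimension three. -/
structure IsPolarForm (ξ : LinearMap.BilinForm F V) : Prop where
  two_ne : (2 : F) ≠ 0
  refl : ∀ u v, ξ u v = 0 → ξ v u = 0
  nondeg : ∀ u, (∀ v, ξ u v = 0) → u = 0
  exists_line : ∃ U, TotallyIsotropic ξ U ∧ 2 ≤ finrank F U
  alt_or_symm : (∀ u, ξ u u = 0) ∨
    (∀ u v, ξ u v = ξ v u) ∧ ∃ U, TotallyIsotropic ξ U ∧ 3 ≤ finrank F U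

variable {ξ : LinearMap.BilinForm F V}

theorem exists_eq_add_of_finrank_two [FiniteDimensional F V] {U : Submodule F V}
    (hU : finrank F U = 2) {y u w : V} (hy : y ∈ U) (hy0 : y ≠ 0) (hu : u ∈ U)
    (huy : u ∉ Submodule.span F {y}) (hw : w ∈ U) : ∃ a b : F, w = a • y + b • u := by
  have hlt : Submodule.span F {y} < Submodule.span F {y, u} := by
    refine lt_of_le_of_ne (Submodule.span_mono (by simp)) fun h => huy ?_
    rw [h]
    exact Submodule.subset_span (by simp)
  have hle : Submodule.span F {y, u} ≤ U :=
    Submodule.span_le.2 (by rintro _ (rfl | rfl) <;> assumption)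
  have h := Submodule.finrank_lt_finrank_of_lt hlt
  rw [finrank_span_singleton hy0] at h
  rw [← Submodule.eq_of_le_of_finrank_le hle (by omega), Submodule.mem_span_pair] at hw
  obtain ⟨a, b, h⟩ := hw
  exact ⟨a, b, h.symm⟩

theorem exists_mem_notMem_of_finrank_lt [FiniteDimensional F V] {U T : Submodule F V}
    (h : finrank F U < finrank F T) : ∃ w ∈ T, w ∉ U :=
  SetLike.not_le_iff_exists.1 fun hle => h.not_ge (Submodule.finrank_mono hle)

theorem finrank_le_finrank_inf_ker [FiniteDimensional F V] (U : Submodule F V) (φ : V →ₗ[F] F) :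
    finrank F U ≤ finrank F (U ⊓ LinearMap.ker φ : Submodule F V) + 1 := by
  have h1 := Submodule.finrank_sup_add_finrank_inf_eq U (LinearMap.ker φ)
  have h2 := φ.finrank_range_add_finrank_ker
  have h3 : finrank F (LinearMap.range φ) ≤ 1 :=
    (Submodule.finrank_le _).trans (finrank_self F).le
  have h4 := Submodule.finrank_le (U ⊔ LinearMap.ker φ)
  omega

theorem TotallyIsotropic.sup_span (hξ : IsPolarForm ξ) {U : Submodule F V}
    (hU : TotallyIsotropic ξ U) {v : V} (hv : ξ v v = 0) (h : ∀ u ∈ U, ξ v u = 0) :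
    TotallyIsotropic ξ (U ⊔ Submodule.span F {v}) := by
  intro a ha b hb
  obtain ⟨u, hu, _, hc, rfl⟩ := Submodule.mem_sup.1 ha
  obtain ⟨c, rfl⟩ := Submodule.mem_span_singleton.1 hc
  obtain ⟨w, hw, _, hd, rfl⟩ := Submodule.mem_sup.1 hb
  obtain ⟨d, rfl⟩ := Submodule.mem_span_singleton.1 hd
  simp [hU u hu w hw, hv, h w hw, hξ.refl _ _ (h u hu)]

theorem TotallyIsotropic.span_pair (hξ : IsPolarForm ξ) {u v : V} (hu : ξ u u = 0)
    (hv : ξ v v = 0) (h : ξ u v = 0) : TotallyIsotropic ξ (Submodule.span F {u, v}) := by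
  intro a ha b hb
  obtain ⟨x, y, rfl⟩ := Submodule.mem_span_pair.1 ha
  obtain ⟨z, w, rfl⟩ := Submodule.mem_span_pair.1 hb
  simp [hu, hv, h, hξ.refl _ _ h]

theorem finrank_span_pair_eq_two {u v : V} (hu : u ≠ 0) (hv : v ∉ Submodule.span F {u}) :
    finrank F (Submodule.span F {u, v}) = 2 := by
  have : LinearIndependent F ![u, v] := by
    refine (LinearIndependent.pair_iff' hu).2 fun a h => hv ?_
    exact Submodule.mem_span_singleton.2 ⟨a, h⟩
  have h := finrank_span_eq_card this
  rw [Matrix.range_cons_cons_empty] at h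
  simpa using h

/-- A totally isotropic subspace can be rotated so as to contain a given isotropic vector, while
keeping its vectors orthogonal to that one. -/
theorem TotallyIsotropic.exists_mem [FiniteDimensional F V] (hξ : IsPolarForm ξ)
    {U : Submodule F V} (hU : TotallyIsotropic ξ U) {n : ℕ} (hn : n ≤ finrank F U) {v : V}
    (hv : ξ v v = 0) : ∃ T, TotallyIsotropic ξ T ∧ n ≤ finrank F T ∧ v ∈ T ∧
      ∀ u ∈ U, ξ v u = 0 → u ∈ T := by
  by_cases hvU : v ∈ U
  · exact ⟨U, hU, hn, hvU, fun u hu _ => hu⟩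
  set A : Submodule F V := U ⊓ LinearMap.ker (ξ v) with hA
  have hAT : TotallyIsotropic ξ A := fun u hu w hw => hU u hu.1 w hw.1
  refine ⟨A ⊔ Submodule.span F {v}, hAT.sup_span hξ hv fun u hu => hu.2, ?_,
    Submodule.mem_sup_right (Submodule.mem_span_singleton_self v),
    fun u hu h => Submodule.mem_sup_left ⟨hu, h⟩⟩
  have h1 := finrank_le_finrank_inf_ker U (ξ v)
  have hlt : A < A ⊔ Submodule.span F {v} := by
    refine lt_of_le_of_ne le_sup_left fun h => hvU ?_
    have : v ∈ A := by
      rw [h]; exact Submodule.mem_sup_right (Submodule.mem_span_singleton_self v)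
    exact this.1
  have h2 := Submodule.finrank_lt_finrank_of_lt hlt
  rw [← hA] at h1
  omega

theorem IsPolarForm.exists_orthogonal_notMem_span [FiniteDimensional F V] (hξ : IsPolarForm ξ)
    {v : V} (hv : ξ v v = 0) (hv0 : v ≠ 0) :
    ∃ w, ξ w w = 0 ∧ ξ v w = 0 ∧ w ∉ Submodule.span F {v} := by
  obtain ⟨U, hU, h2⟩ := hξ.exists_line
  obtain ⟨T, hT, h2, hvT, -⟩ := hU.exists_mem hξ h2 hv
  obtain ⟨w, hw, hwv⟩ := exists_mem_notMem_of_finrank_lt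
    (U := Submodule.span F {v}) (T := T) (by rw [finrank_span_singleton hv0]; omega)
  exact ⟨w, hT w hw w hw, hT v hvT w hw, hwv⟩

/-- The component of `v` orthogonal to the hyperbolic pair `y`, `z`. -/
def orthProj (ξ : LinearMap.BilinForm F V) (y z v : V) : V :=
  v - (ξ z v / ξ z y) • y - (ξ y v / ξ y z) • z

theorem orthProj_spec {y z : V} (hy : ξ y y = 0) (hz : ξ z z = 0) (hyz : ξ y z ≠ 0)
    (hzy : ξ z y ≠ 0) (v : V) : ξ y (orthProj ξ y z v) = 0 ∧ ξ z (orthProj ξ y z v) = 0 := by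
  simp [orthProj, hy, hz, hyz, hzy]

theorem apply_orthProj {e y z : V} (hy : ξ e y = 0) (hz : ξ e z = 0) (v : V) :
    ξ e (orthProj ξ y z v) = ξ e v := by
  simp [orthProj, hy, hz]

/-- A symmetric form whose restriction to `U` has an isotropic vector outside its radical has enough
isotropic vectors in `U` to span `U`; for an alternating form there is nothing to show. -/
theorem eq_zero_of_isotropic (h2 : (2 : F) ≠ 0) {U : Submodule F V}
    (hU : (∀ u, ξ u u = 0) ∨ (∀ u v, ξ u v = ξ v u) ∧ ∃ e ∈ U, ∃ f ∈ U, ξ e e = 0 ∧ ξ e f ≠ 0)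
    (φ : V →ₗ[F] F) (hφ : ∀ w ∈ U, ξ w w = 0 → φ w = 0) : ∀ w ∈ U, φ w = 0 := by
  rcases hU with h | ⟨hs, e, he, f, hf, hee, hef⟩
  · exact fun w hw => hφ w hw (h w)
  have key : ∀ v ∈ U, ξ e v ≠ 0 → φ v = 0 := by
    intro v hv hev
    have h := hφ (v - (ξ v v / (2 * ξ e v)) • e) (U.sub_mem hv (U.smul_mem _ he)) (by
      simp [hee, hs v e]
      field_simp
      ring)
    simpa [hφ e he hee] using h
  intro w hw
  by_cases hew : ξ e w = 0
  · have h := key (w + f) (U.add_mem hw hf) (by simpa [hew] using hef)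
    simpa [key f hf hef] using h
  · exact key w hw hew

variable [FiniteDimensional F V]

/-- A functional that vanishes on all isotropic vectors orthogonal to the hyperbolic pair `y`, `z`
is a combination of `ξ y` and `ξ z`. -/
theorem IsPolarForm.eq_combination (hξ : IsPolarForm ξ) {y z : V} (hy : ξ y y = 0)
    (hz : ξ z z = 0) (hyz : ξ y z ≠ 0) (φ : V →ₗ[F] F)
    (hφ : ∀ w, ξ w w = 0 → ξ y w = 0 → ξ z w = 0 → φ w = 0) (v : V) :
    φ v = ξ z v / ξ z y * φ y + ξ y v / ξ y z * φ z := by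
  have hzy : ξ z y ≠ 0 := fun h => hyz (hξ.refl _ _ h)
  have h := eq_zero_of_isotropic (ξ := ξ) hξ.two_ne
    (U := LinearMap.ker (ξ y) ⊓ LinearMap.ker (ξ z)) ?_ φ
    (fun w hw hww => hφ w hww hw.1 hw.2) (orthProj ξ y z v) (orthProj_spec hy hz hyz hzy v)
  · rw [orthProj, map_sub, map_sub, map_smul, map_smul, smul_eq_mul, smul_eq_mul] at h
    linear_combination h
  · refine hξ.alt_or_symm.imp_right fun ⟨hs, T, hT, h3⟩ => ⟨hs, ?_⟩
    have h1 := finrank_le_finrank_inf_ker T (ξ y)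
    have h2 := finrank_le_finrank_inf_ker (T ⊓ LinearMap.ker (ξ y)) (ξ z)
    obtain ⟨e, ⟨⟨heT, hye⟩, hze⟩, he0⟩ := exists_mem_notMem_of_finrank_lt (U := (⊥ : Submodule F V))
      (T := T ⊓ LinearMap.ker (ξ y) ⊓ LinearMap.ker (ξ z)) (by rw [finrank_bot]; omega)
    obtain ⟨f, hf⟩ : ∃ f, ξ e f ≠ 0 := by
      by_contra! hc
      exact he0 (hξ.nondeg e hc)
    exact ⟨e, ⟨hye, hze⟩, orthProj ξ y z f, orthProj_spec hy hz hyz hzy f, hT e heT e heT,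
      by rwa [apply_orthProj (hξ.refl _ _ hye) (hξ.refl _ _ hze)]⟩

/-- Two totally isotropic lines outside a hyperplane `ker φ` are linked by a path of two steps
outside that hyperplane. If `z` is not on the line `U` and no suitable path from `y ∈ U` to `z`
exists, then `φ` is represented by a vector of the line `y z`; for two choices of `y` this is
impossible. -/
theorem IsPolarForm.exists_link (hξ : IsPolarForm ξ) (φ : V →ₗ[F] F) {U T : Submodule F V}
    (hU2 : finrank F U = 2) (hU : TotallyIsotropic ξ U) (hT : TotallyIsotropic ξ T)
    (hφU : ∃ y ∈ U, φ y ≠ 0) (hφT : ∃ z ∈ T, φ z ≠ 0) :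
    ∃ y ∈ U, ∃ z ∈ T, ∃ w, ξ w w = 0 ∧ φ y ≠ 0 ∧ φ z ≠ 0 ∧ φ w ≠ 0 ∧ ξ y w = 0 ∧ ξ w z = 0 := by
  obtain ⟨z, hz, hφz⟩ := hφT
  have hzz := hT z hz z hz
  by_cases hzU : z ∈ U
  · exact ⟨z, hzU, z, hz, z, hzz, hφz, hφz, hφz, hzz, hzz⟩
  by_contra! hc
  have key : ∀ y ∈ U, φ y ≠ 0 → ξ y z ≠ 0 ∧ ξ z y ≠ 0 ∧
      ∀ v, φ v = ξ z v / ξ z y * φ y + ξ y v / ξ y z * φ z := by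
    intro y hy hφy
    have hyz : ξ y z ≠ 0 := fun h => hc y hy z hz z hzz hφy hφz hφz h hzz
    refine ⟨hyz, fun h => hyz (hξ.refl _ _ h), fun v => hξ.eq_combination (hU y hy y hy) hzz hyz φ
      (fun w hww hyw hzw => ?_) v⟩
    by_contra hφw
    exact hc y hy z hz w hww hφy hφz hφw hyw (hξ.refl _ _ hzw)
  obtain ⟨y, hy, hφy⟩ := hφU
  have hy0 : y ≠ 0 := by rintro rfl; simp at hφy
  obtain ⟨u, hu, huy, hφu⟩ : ∃ u ∈ U, u ∉ Submodule.span F {y} ∧ φ u ≠ 0 := by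
    obtain ⟨u, hu, huy⟩ := exists_mem_notMem_of_finrank_lt
      (U := Submodule.span F {y}) (T := U) (by rw [finrank_span_singleton hy0]; omega)
    by_cases h : φ u = 0
    · refine ⟨u + y, U.add_mem hu hy, fun h' => huy ?_, by simpa [h] using hφy⟩
      simpa using Submodule.sub_mem _ h' (Submodule.mem_span_singleton_self y)
    · exact ⟨u, hu, huy, h⟩
  obtain ⟨h1, h2, h3⟩ := key y hy hφy
  obtain ⟨h4, h5, h6⟩ := key u hu hφu
  have h0 := hξ.nondeg ((φ y / ξ z y - φ u / ξ z u) • z + (φ z / ξ y z) • y - (φ z / ξ u z) • u)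
    fun v => by
      simp only [map_add, map_sub, map_smul, LinearMap.add_apply, LinearMap.sub_apply,
        LinearMap.smul_apply, smul_eq_mul]
      linear_combination h6 v - h3 v
  by_cases hα : φ y / ξ z y - φ u / ξ z u = 0
  · refine huy (Submodule.mem_span_singleton.2 ⟨(φ z / ξ u z)⁻¹ * (φ z / ξ y z), ?_⟩)
    rw [hα, zero_smul, zero_add, sub_eq_zero] at h0
    rw [mul_smul, h0, inv_smul_smul₀ (div_ne_zero hφz h4)]
  · refine hzU ((U.smul_mem_iff hα).1 ?_)
    have : (φ y / ξ z y - φ u / ξ z u) • z = (φ z / ξ u z) • u - (φ z / ξ y z) • y := by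
      rw [eq_sub_iff_add_eq, ← sub_eq_zero]; exact h0
    rw [this]
    exact U.sub_mem (U.smul_mem _ hu) (U.smul_mem _ hy)

/-- If some totally isotropic subspace has dimension three, then every totally isotropic line lies
in one. -/
theorem IsPolarForm.exists_plane (hξ : IsPolarForm ξ)
    (h3 : ∃ U, TotallyIsotropic ξ U ∧ 3 ≤ finrank F U) {y v : V} (hy : ξ y y = 0)
    (hv : ξ v v = 0) (hyv : ξ y v = 0) :
    ∃ T, TotallyIsotropic ξ T ∧ 3 ≤ finrank F T ∧ y ∈ T ∧ v ∈ T := by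
  obtain ⟨U, hU, h3⟩ := h3
  obtain ⟨T, hT, h3, hyT, -⟩ := hU.exists_mem hξ h3 hy
  obtain ⟨T', hT', h3, hvT', h⟩ := hT.exists_mem hξ h3 hv
  exact ⟨T', hT', h3, h y hyT (hξ.refl _ _ hyv), hvT'⟩

end Forms

/-! ### The polar space of a form -/

section PolarSpace

open Module

variable {F V : Type*} [Field F] [AddCommGroup V] [Module F V]
variable {ξ η : LinearMap.BilinForm F V}

theorem mem_pointsOf_iff {p : ℙ F V} {U : Submodule F V} : p ∈ pointsOf U ↔ p.rep ∈ U := by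
  rw [pointsOf, Set.mem_ofPred_eq, Projectivization.submodule_eq, Submodule.span_singleton_le_iff_mem]

theorem mem_conjugates_iff {p q : ℙ F V} : q ∈ conjugates ξ p ↔ ξ q.rep p.rep = 0 := by
  simp only [conjugates, Set.mem_ofPred_eq, Projectivization.submodule_eq,
    Submodule.mem_span_singleton]
  constructor
  · exact fun h => h _ ⟨1, one_smul _ _⟩ _ ⟨1, one_smul _ _⟩
  · rintro h _ ⟨a, rfl⟩ _ ⟨b, rfl⟩
    simp [h]

/-- The isotropic points of the form `ξ`. -/
abbrev IsotropicPoint (ξ : LinearMap.BilinForm F V) : Type _ := selfConjPoints (conjugates ξ)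

namespace IsotropicPoint

/-- A vector that spans the isotropic point `x`. -/
noncomputable def vec (x : IsotropicPoint ξ) : V := x.1.rep

theorem vec_ne_zero (x : IsotropicPoint ξ) : x.vec ≠ 0 := x.1.rep_nonzero

theorem form_vec (x : IsotropicPoint ξ) : ξ x.vec x.vec = 0 := mem_conjugates_iff.1 x.2

theorem exists_vec_eq {v : V} (h0 : v ≠ 0) (hv : ξ v v = 0) :
    ∃ (x : IsotropicPoint ξ) (c : F), c ≠ 0 ∧ x.vec = c • v := by
  obtain ⟨c, hc⟩ := Projectivization.exists_smul_eq_mk_rep F v h0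
  refine ⟨⟨Projectivization.mk F v h0, mem_conjugates_iff.2 ?_⟩, c, c.ne_zero, hc.symm⟩
  rw [← hc]
  simp [Units.smul_def, hv]

theorem vec_mem_span {x y : IsotropicPoint ξ} : y.vec ∈ Submodule.span F {x.vec} ↔ x = y := by
  constructor
  · intro h
    obtain ⟨a, ha⟩ := Submodule.mem_span_singleton.1 h
    apply Subtype.ext
    rw [← Projectivization.mk_rep x.1, ← Projectivization.mk_rep y.1]
    exact ((Projectivization.mk_eq_mk_iff' F _ _ _ _).2 ⟨a, ha⟩).symm
  · rintro rfl
    exact Submodule.mem_span_singleton_self _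

end IsotropicPoint

open IsotropicPoint

/-- The set of isotropic points in the subspace `U`. -/
def isotropicPointsIn (ξ : LinearMap.BilinForm F V) (U : Submodule F V) : Set (IsotropicPoint ξ) :=
  {x | x.vec ∈ U}

theorem selfConjSubspaces_iff {m : ℕ} {X : Set (ℙ F V)} :
    X ∈ selfConjSubspaces (conjugates ξ) m ↔
      ∃ U : Submodule F V, finrank F U = m + 1 ∧ TotallyIsotropic ξ U ∧ X = pointsOf U := by
  constructor
  · rintro ⟨⟨U, hU, rfl⟩, h⟩
    refine ⟨U, hU, fun u hu v hv => ?_, rfl⟩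
    by_cases hu0 : u = 0
    · simp [hu0]
    by_cases hv0 : v = 0
    · simp [hv0]
    have hu' : Projectivization.mk F u hu0 ∈ pointsOf U := by
      simpa [pointsOf, Projectivization.submodule_mk] using hu
    have hv' : Projectivization.mk F v hv0 ∈ pointsOf U := by
      simpa [pointsOf, Projectivization.submodule_mk] using hv
    refine Set.mem_iInter₂.1 (h hu') _ hv' u ?_ v ?_ <;> rw [Projectivization.submodule_mk] <;>
      exact Submodule.mem_span_singleton_self _
  · rintro ⟨U, hU, hT, rfl⟩
    exact ⟨⟨U, hU, rfl⟩, fun p hp => Set.mem_iInter₂.2 fun q hq => mem_conjugates_iff.2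
      (hT _ (mem_pointsOf_iff.1 hp) _ (mem_pointsOf_iff.1 hq))⟩

theorem mem_polarSpace_lines {L : Set (IsotropicPoint ξ)} :
    L ∈ (polarSpace (conjugates ξ)).lines ↔
      ∃ U : Submodule F V, finrank F U = 2 ∧ TotallyIsotropic ξ U ∧ L = isotropicPointsIn ξ U := by
  have key : ∀ U : Submodule F V,
      (Subtype.val ⁻¹' pointsOf U : Set (IsotropicPoint ξ)) = isotropicPointsIn ξ U :=
    fun U => Set.ext fun x => mem_pointsOf_iff
  constructor
  · rintro ⟨X, hX, rfl⟩
    obtain ⟨U, hU, hT, rfl⟩ := selfConjSubspaces_iff.1 hX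
    exact ⟨U, hU, hT, key U⟩
  · rintro ⟨U, hU, hT, rfl⟩
    exact ⟨_, selfConjSubspaces_iff.2 ⟨U, hU, hT, rfl⟩, (key U).symm⟩

theorem far_iff (hη : η.IsAlt) {x y : IsotropicPoint ξ} :
    Far (polarHyperplane (conjugates ξ) (conjugates η)) x y ↔ η x.vec y.vec ≠ 0 := by
  refine not_congr ?_
  have hval : ((pair x y).map Subtype.val : Multiset (ℙ F V)) = {x.1, y.1} := by
    simp [pair]
  have hcomm := hη.neg_eq x.vec y.vec
  constructor
  · rintro ⟨a, b, hab, h⟩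
    rw [hval] at h
    have h : pair x.1 y.1 = pair a b := Subtype.ext h
    have hab := mem_conjugates_iff.1 hab
    rcases pair_eq_pair.1 h with ⟨rfl, rfl⟩ | ⟨rfl, rfl⟩
    · exact neg_eq_zero.1 (hcomm.trans hab)
    · exact hab
  · intro h
    refine ⟨x.1, y.1, mem_conjugates_iff.2 ?_, hval⟩
    exact hcomm.symm.trans (neg_eq_zero.2 h)

/-- Points of a projective line `u v` other than `v`, parametrized by the field. -/
theorem exists_pencil {u v : V} (hv : v ≠ 0) (huv : u ∉ Submodule.span F {v})
    (h : ∀ a : F, ξ (u + a • v) (u + a • v) = 0) :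
    ∃ P : F → IsotropicPoint ξ, Function.Injective P ∧
      (∀ a, ∃ c : F, c ≠ 0 ∧ (P a).vec = c • (u + a • v)) ∧
      ∀ a, (P a).vec ∉ Submodule.span F {v} := by
  have hmem : ∀ a, u + a • v ∉ Submodule.span F {v} := fun a ha => huv (by
    simpa using Submodule.sub_mem _ ha
      (Submodule.smul_mem _ a (Submodule.mem_span_singleton_self v)))
  have h0 : ∀ a, u + a • v ≠ 0 := fun a h => hmem a (h ▸ Submodule.zero_mem _)
  choose P c hc hP using fun a : F => exists_vec_eq (ξ := ξ) (h0 a) (h a)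
  refine ⟨P, fun a b hab => ?_, fun a => ⟨c a, hc a, hP a⟩, fun a ha => ?_⟩
  · have heq : c a • (u + a • v) = c b • (u + b • v) := by rw [← hP, ← hP, hab]
    have h1 : (c a - c b) • u = (c b * b - c a * a) • v := by
      rw [← sub_eq_zero] at heq ⊢
      rw [← heq]
      module
    by_cases hcc : c a - c b = 0
    · rw [hcc, zero_smul, eq_comm, smul_eq_zero, or_iff_left hv, ← sub_eq_zero.1 hcc, ← mul_sub,
        mul_eq_zero, or_iff_right (hc a)] at h1
      exact (sub_eq_zero.1 h1).symm
    · refine (huv (((Submodule.span F {v}).smul_mem_iff hcc).1 ?_)).elim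
      rw [h1]
      exact Submodule.smul_mem _ _ (Submodule.mem_span_singleton_self v)
  · rw [hP, Submodule.smul_mem_iff _ (hc a)] at ha
    exact hmem a ha

variable [FiniteDimensional F V]

theorem collinear_iff (hξ : IsPolarForm ξ) {x y : IsotropicPoint ξ} :
    (polarSpace (conjugates ξ)).Collinear x y ↔ ξ x.vec y.vec = 0 := by
  constructor
  · rintro ⟨L, hL, hx, hy⟩
    obtain ⟨U, -, hT, rfl⟩ := mem_polarSpace_lines.1 hL
    exact hT _ hx _ hy
  · intro h
    obtain ⟨w, hww, hxw, hwx, hy⟩ : ∃ w, ξ w w = 0 ∧ ξ x.vec w = 0 ∧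
        w ∉ Submodule.span F {x.vec} ∧ y.vec ∈ Submodule.span F {x.vec, w} := by
      by_cases hxy : x = y
      · obtain ⟨w, h1, h2, h3⟩ := hξ.exists_orthogonal_notMem_span x.form_vec x.vec_ne_zero
        exact ⟨w, h1, h2, h3, Submodule.subset_span (by simp [hxy])⟩
      · exact ⟨y.vec, y.form_vec, h, fun h => hxy (vec_mem_span.1 h),
          Submodule.subset_span (by simp)⟩
    exact ⟨_, mem_polarSpace_lines.2 ⟨_, finrank_span_pair_eq_two x.vec_ne_zero hwx,
      TotallyIsotropic.span_pair hξ x.form_vec hww hxw, rfl⟩,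
      Submodule.subset_span (by simp), hy⟩

theorem exists_notMem_span {U : Submodule F V} (hU : finrank F U = 2) (v : V) :
    ∃ w ∈ U, w ∉ Submodule.span F {v} := by
  refine exists_mem_notMem_of_finrank_lt ?_
  have := finrank_span_le_card (R := F) ({v} : Set V)
  simp at this
  omega

theorem four_le_isotropicPointsIn (h2 : (2 : F) ≠ 0) {U : Submodule F V} (hU : finrank F U = 2)
    (hT : TotallyIsotropic ξ U) : 4 ≤ (isotropicPointsIn ξ U).encard := by
  obtain ⟨v, hv, hv0⟩ := exists_notMem_span hU (0 : V)
  obtain ⟨u, hu, huv⟩ := exists_notMem_span hU v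
  have hv0 : v ≠ 0 := by rintro rfl; simp at hv0
  obtain ⟨P, hP, hPu, hPv⟩ := exists_pencil (ξ := ξ) hv0 huv fun a =>
    have h := U.add_mem hu (U.smul_mem a hv)
    hT _ h _ h
  obtain ⟨x, d, hd, hx⟩ := exists_vec_eq hv0 (hT v hv v hv)
  have hPx : ∀ a, x ≠ P a := fun a h => hPv a (by
    rw [← h, hx]
    exact Submodule.smul_mem _ _ (Submodule.mem_span_singleton_self v))
  have h1 : (1 : F) ≠ -1 := fun h => h2 (by linear_combination h)
  have hsub : ({x, P 0, P 1, P (-1)} : Set (IsotropicPoint ξ)) ⊆ isotropicPointsIn ξ U := by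
    have hPU : ∀ a, P a ∈ isotropicPointsIn ξ U := by
      intro a
      obtain ⟨c, -, hc⟩ := hPu a
      change (P a).vec ∈ U
      exact hc ▸ U.smul_mem c (U.add_mem hu (U.smul_mem a hv))
    rintro y (rfl | rfl | rfl | rfl)
    · change y.vec ∈ U
      exact hx ▸ U.smul_mem d hv
    all_goals exact hPU _
  refine le_trans (le_of_eq ?_) (Set.encard_le_encard hsub)
  rw [Set.encard_insert_of_notMem (by simp [hPx]), Set.encard_insert_of_notMem (by
    simp [hP.eq_iff]), Set.encard_insert_of_notMem (by simpa [hP.eq_iff] using h1),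
    Set.encard_singleton]
  norm_num

end PolarSpace

/-! ### Planes and distances in the polar space of a form -/

section PolarPairs

open Module IsotropicPoint

variable {F V : Type*} [Field F] [AddCommGroup V] [Module F V]
variable {ξ η : LinearMap.BilinForm F V}

/-- Far from any point of a polar space there is a point, as the isotropic vectors span. -/
theorem exists_far_point (hξ : IsPolarForm ξ) {φ : V →ₗ[F] F} (hφ : φ ≠ 0)
    (x : IsotropicPoint ξ) : ∃ y : IsotropicPoint ξ, φ y.vec ≠ 0 := by
  by_contra! hc
  refine hφ (LinearMap.ext fun w => ?_)
  refine eq_zero_of_isotropic (ξ := ξ) hξ.two_ne (U := ⊤) ?_ φ (fun w _ hw => ?_) w trivial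
  · refine hξ.alt_or_symm.imp_right fun h => ⟨h.1, x.vec, trivial, ?_⟩
    by_contra! hf
    exact x.vec_ne_zero (hξ.nondeg _ fun f => hf f trivial x.form_vec)
  · by_cases hw0 : w = 0
    · rw [hw0, map_zero]
    · obtain ⟨y, c, hc0, hy⟩ := exists_vec_eq hw0 hw
      have h := hc y
      rw [hy, map_smul, smul_eq_mul, mul_eq_zero, or_iff_right hc0] at h
      exact h

variable [FiniteDimensional F V]

theorem eq_of_mem_lines {U T : Submodule F V} (hU : finrank F U = 2) (hT : finrank F T = 2)
    {u v : V} (hu0 : u ≠ 0) (huU : u ∈ U) (huT : u ∈ T) (hvU : v ∈ U) (hvT : v ∈ T)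
    (huv : v ∉ Submodule.span F {u}) : U = T := by
  have sub : ∀ U T : Submodule F V, finrank F U = 2 → u ∈ U → u ∈ T → v ∈ U → v ∈ T → U ≤ T := by
    intro U T hU huU huT hvU hvT w hw
    obtain ⟨a, b, rfl⟩ := exists_eq_add_of_finrank_two hU huU hu0 hvU huv hw
    exact T.add_mem (T.smul_mem _ huT) (T.smul_mem _ hvT)
  exact (sub U T hU huU huT hvU hvT).antisymm (sub T U hT huT huU hvT hvU)

/-- In the presence of planes, every line through `y` is coplanar with another one, and two lines
through `y` that span no plane are both coplanar with a third one. -/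
theorem planes_of_exists (hξ : IsPolarForm ξ)
    (h3 : ∃ U, TotallyIsotropic ξ U ∧ 3 ≤ finrank F U) {U : Submodule F V} (hU2 : finrank F U = 2)
    (hU : TotallyIsotropic ξ U) {y : V} (hy : y ∈ U) (hy0 : y ≠ 0) :
    (∃ N : Submodule F V, finrank F N = 2 ∧ TotallyIsotropic ξ N ∧ y ∈ N ∧ U ≠ N ∧
      ∀ u ∈ U, ∀ v ∈ N, ξ u v = 0) ∧
    ∀ T : Submodule F V, finrank F T = 2 → TotallyIsotropic ξ T → y ∈ T →
      (∀ u ∈ U, ∀ v ∈ T, ξ u v = 0) ∨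
      ∃ N : Submodule F V, finrank F N = 2 ∧ TotallyIsotropic ξ N ∧ y ∈ N ∧ U ≠ N ∧ N ≠ T ∧
        (∀ u ∈ U, ∀ v ∈ N, ξ u v = 0) ∧ ∀ u ∈ N, ∀ v ∈ T, ξ u v = 0 := by
  have hyy := hU y hy y hy
  -- a totally isotropic subspace of dimension three through `y` and `u` contains `U`
  have key : ∀ u ∈ U, u ∉ Submodule.span F {y} →
      ∃ R : Submodule F V, TotallyIsotropic ξ R ∧ 3 ≤ finrank F R ∧ U ≤ R := by
    intro u hu huy
    obtain ⟨R, hR, hR3, hyR, huR⟩ := hξ.exists_plane h3 hyy (hU u hu u hu) (hU y hy u hu)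
    refine ⟨R, hR, hR3, fun w hw => ?_⟩
    obtain ⟨a, b, rfl⟩ := exists_eq_add_of_finrank_two hU2 hy hy0 hu huy hw
    exact R.add_mem (R.smul_mem _ hyR) (R.smul_mem _ huR)
  constructor
  · obtain ⟨u, hu, huy⟩ := exists_notMem_span hU2 y
    obtain ⟨R, hR, hR3, hUR⟩ := key u hu huy
    obtain ⟨w, hw, hwU⟩ := exists_mem_notMem_of_finrank_lt (U := U) (T := R) (by omega)
    have hwy : w ∉ Submodule.span F {y} := fun h =>
      hwU ((Submodule.span_singleton_le_iff_mem _ _).2 hy h)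
    refine ⟨Submodule.span F {y, w}, finrank_span_pair_eq_two hy0 hwy,
      .span_pair hξ hyy (hR w hw w hw) (hR y (hUR hy) w hw), Submodule.subset_span (by simp), ?_, ?_⟩
    · intro h
      exact hwU (h ▸ Submodule.subset_span (by simp))
    · intro a ha b hb
      have hle : Submodule.span F {y, w} ≤ R :=
        Submodule.span_le.2 (by rintro _ (rfl | rfl); exacts [hUR hy, hw])
      exact hR a (hUR ha) b (hle hb)
  · intro T hT2 hT hyT
    refine or_iff_not_imp_left.2 fun hc => ?_
    push Not at hc
    obtain ⟨u, hu, v, hv, huv⟩ := hc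
    have huy : u ∉ Submodule.span F {y} := by
      intro h
      obtain ⟨a, rfl⟩ := Submodule.mem_span_singleton.1 h
      simp [hT y hyT v hv] at huv
    have hvy : v ∉ Submodule.span F {y} := by
      intro h
      obtain ⟨a, rfl⟩ := Submodule.mem_span_singleton.1 h
      simp [hU u hu y hy] at huv
    obtain ⟨R, hR, hR3, hUR⟩ := key u hu huy
    have h1 := finrank_le_finrank_inf_ker R (ξ v)
    obtain ⟨w, ⟨hw, hvw⟩, hwy⟩ := exists_mem_notMem_of_finrank_lt
      (U := Submodule.span F {y}) (T := R ⊓ LinearMap.ker (ξ v))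
      (by rw [finrank_span_singleton hy0]; omega)
    have hNU : ∀ a ∈ U, ∀ b ∈ Submodule.span F {y, w}, ξ a b = 0 := by
      intro a ha b hb
      have hle : Submodule.span F {y, w} ≤ R :=
        Submodule.span_le.2 (by rintro _ (rfl | rfl); exacts [hUR hy, hw])
      exact hR a (hUR ha) b (hle hb)
    have hNT : ∀ a ∈ Submodule.span F {y, w}, ∀ b ∈ T, ξ a b = 0 := by
      intro a ha b hb
      obtain ⟨c, d, rfl⟩ := exists_eq_add_of_finrank_two hT2 hyT hy0 hv hvy hb
      obtain ⟨e, f, rfl⟩ := Submodule.mem_span_pair.1 ha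
      simp [hyy, hT y hyT v hv, hξ.refl _ _ (hR y (hUR hy) w hw), hξ.refl _ _ hvw]
    refine ⟨Submodule.span F {y, w}, finrank_span_pair_eq_two hy0 hwy,
      .span_pair hξ hyy (hR w hw w hw) (hR y (hUR hy) w hw), Submodule.subset_span (by simp), ?_, ?_,
      hNU, hNT⟩
    · exact fun h => huv (hNT u (h ▸ hu) v hv)
    · exact fun h => huv (hNU u hu v (h ▸ hv))

theorem polarPair_of_isPolarForm (hξ : IsPolarForm ξ) (hη : η.IsAlt)
    (hη0 : ∀ u, (∀ v, η u v = 0) → u = 0) :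
    PolarPair (S := IsotropicPoint ξ) (polarSpace (conjugates ξ))
      (polarHyperplane (conjugates ξ) (conjugates η)) where
  far_irrefl x := by
    rw [far_iff hη]
    exact not_not.2 (hη.self_eq_zero _)
  line_unique L hL M hM x y hxy hxL hyL hxM hyM := by
    obtain ⟨U, hU2, hU, rfl⟩ := mem_polarSpace_lines.1 hL
    obtain ⟨T, hT2, hT, rfl⟩ := mem_polarSpace_lines.1 hM
    rw [eq_of_mem_lines hU2 hT2 x.vec_ne_zero hxL hxM hyL hyM fun h => hxy (vec_mem_span.1 h)]
  not_far_unique L hL a u v z haz hz hu hv hau hav := by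
    obtain ⟨U, hU2, hU, rfl⟩ := mem_polarSpace_lines.1 hL
    rw [far_iff hη] at haz hau hav
    by_contra huv
    obtain ⟨b, c, h⟩ := exists_eq_add_of_finrank_two hU2 hu u.vec_ne_zero hv
      (fun h => huv (vec_mem_span.1 h)) hz
    refine haz ?_
    rw [h, map_add, map_smul, map_smul, not_not.1 hau, not_not.1 hav, smul_zero, smul_zero, add_zero]
  four_le L hL := by
    obtain ⟨U, hU2, hU, rfl⟩ := mem_polarSpace_lines.1 hL
    exact four_le_isotropicPointsIn hξ.two_ne hU2 hU
  exists_far x := by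
    obtain ⟨y, hy⟩ := exists_far_point hξ (φ := η x.vec)
      (fun h => x.vec_ne_zero (hη0 _ fun v => by rw [h, LinearMap.zero_apply])) x
    exact ⟨y, (far_iff hη).2 hy⟩
  exists_line x := by
    obtain ⟨L, hL, hx, -⟩ := (collinear_iff hξ).2 x.form_vec
    exact ⟨L, hL, hx⟩
  exists_link x L hL M hM := by
    rintro ⟨y, hy, hxy⟩ ⟨z, hz, hxz⟩
    obtain ⟨U, hU2, hU, rfl⟩ := mem_polarSpace_lines.1 hL
    obtain ⟨T, hT2, hT, rfl⟩ := mem_polarSpace_lines.1 hM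
    obtain ⟨y, hy, z, hz, w, hww, h1, h2, h3, h4, h5⟩ := hξ.exists_link (η x.vec) hU2 hU hT
      ⟨y.vec, hy, (far_iff hη).1 hxy⟩ ⟨z.vec, hz, (far_iff hη).1 hxz⟩
    have pt : ∀ v, ξ v v = 0 → η x.vec v ≠ 0 →
        ∃ (p : IsotropicPoint ξ) (c : F), c ≠ 0 ∧ p.vec = c • v := fun v hv h =>
      exists_vec_eq (by rintro rfl; simp at h) hv
    obtain ⟨y', a, ha, hy'⟩ := pt y (hU y hy y hy) h1
    obtain ⟨z', b, hb, hz'⟩ := pt z (hT z hz z hz) h2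
    obtain ⟨w', c, hc, hw'⟩ := pt w hww h3
    simp only [far_iff hη, collinear_iff hξ]
    refine ⟨y', ?_, z', ?_, w', ?_⟩
    · change y'.vec ∈ U
      exact hy' ▸ U.smul_mem a hy
    · change z'.vec ∈ T
      exact hz' ▸ T.smul_mem b hz
    · simp only [hy', hz', hw', map_smul, LinearMap.smul_apply, h4, h5, smul_zero]
      simp [h1, h2, h3, ha, hb, hc]
  planes_or_no_planes := by
    simp only [far_iff hη, collinear_iff hξ]
    have vec_of : ∀ {U T : Submodule F V}, (∀ u ∈ U, ∀ v ∈ T, ξ u v = 0) →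
        ∀ u ∈ isotropicPointsIn ξ U, ∀ v ∈ isotropicPointsIn ξ T, ξ u.vec v.vec = 0 :=
      fun h u hu v hv => h _ hu _ hv
    have ne_of : ∀ {U T : Submodule F V}, TotallyIsotropic ξ U → TotallyIsotropic ξ T → U ≠ T →
        isotropicPointsIn ξ U ≠ isotropicPointsIn ξ T := by
      have sub : ∀ {U T : Submodule F V}, TotallyIsotropic ξ U →
          isotropicPointsIn ξ U = isotropicPointsIn ξ T → U ≤ T := by
        intro U T hU h w hw
        by_cases hw0 : w = 0
        · exact hw0 ▸ T.zero_mem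
        obtain ⟨x, c, hc, hx⟩ := exists_vec_eq hw0 (hU w hw w hw)
        have hxU : x ∈ isotropicPointsIn ξ U := by
          change x.vec ∈ U
          exact hx ▸ U.smul_mem c hw
        rw [h] at hxU
        change x.vec ∈ T at hxU
        rwa [hx, T.smul_mem_iff hc] at hxU
      intro U T hU hT hne h
      exact hne ((sub hU h).antisymm (sub hT h.symm))
    by_cases h3 : ∃ U, TotallyIsotropic ξ U ∧ 3 ≤ finrank F U
    · left
      constructor
      · intro L hL y hy
        obtain ⟨U, hU2, hU, rfl⟩ := mem_polarSpace_lines.1 hL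
        obtain ⟨N, hN2, hN, hyN, hUN, h⟩ :=
          (planes_of_exists hξ h3 hU2 hU hy y.vec_ne_zero).1
        exact ⟨_, mem_polarSpace_lines.2 ⟨N, hN2, hN, rfl⟩, hyN, ne_of hU hN hUN, vec_of h⟩
      · intro L hL M hM y hyL hyM
        obtain ⟨U, hU2, hU, rfl⟩ := mem_polarSpace_lines.1 hL
        obtain ⟨T, hT2, hT, rfl⟩ := mem_polarSpace_lines.1 hM
        rcases (planes_of_exists hξ h3 hU2 hU hyL y.vec_ne_zero).2 T hT2 hT hyM with
          h | ⟨N, hN2, hN, hyN, hUN, hNT, h, h'⟩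
        · exact Or.inl (vec_of h)
        · exact Or.inr ⟨_, mem_polarSpace_lines.2 ⟨N, hN2, hN, rfl⟩, hyN, ne_of hU hN hUN,
            ne_of hN hT hNT, vec_of h, vec_of h'⟩
    · right
      have halt : ∀ u, ξ u u = 0 := hξ.alt_or_symm.resolve_right fun h => h3 h.2
      constructor
      · intro L hL M hM hLM y hyL hyM u hu v hv huy hvy huv
        obtain ⟨U, hU2, hU, rfl⟩ := mem_polarSpace_lines.1 hL
        obtain ⟨T, hT2, hT, rfl⟩ := mem_polarSpace_lines.1 hM
        -- otherwise the subspace spanned by `U` and `v` is totally isotropic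
        refine h3 ⟨_, hU.sup_span hξ v.form_vec fun w hw => ?_, ?_⟩
        · obtain ⟨a, b, rfl⟩ := exists_eq_add_of_finrank_two hU2 hyL y.vec_ne_zero hu
            (fun h => huy (vec_mem_span.1 h).symm) hw
          simp [hT _ hv _ hyM, hξ.refl _ _ huv]
        · have hlt : U < U ⊔ Submodule.span F {v.vec} := by
            refine lt_of_le_of_ne le_sup_left fun h => hLM ?_
            have hvU : v.vec ∈ U := by
              rw [h]; exact Submodule.mem_sup_right (Submodule.mem_span_singleton_self _)
            rw [eq_of_mem_lines hU2 hT2 y.vec_ne_zero hyL hyM hvU hv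
              fun h => hvy (vec_mem_span.1 h).symm]
          have := Submodule.finrank_lt_finrank_of_lt hlt
          omega
      · intro x y u v hxy huy hvy huv
        obtain ⟨f, hf⟩ : ∃ f, ξ y.vec f ≠ 0 := by
          by_contra! hc
          exact y.vec_ne_zero (hξ.nondeg _ hc)
        have hvu : ξ v.vec u.vec ≠ 0 := fun h => huv (hξ.refl _ _ h)
        -- a vector orthogonal to `u`, `v` and outside the line spanned by `y`, corrected by a
        -- multiple of `y` so as to lie in the hyperplane of `x`
        obtain ⟨z, hyz, huz, hvz, hxz⟩ :
            ∃ z, ξ y.vec z ≠ 0 ∧ ξ u.vec z = 0 ∧ ξ v.vec z = 0 ∧ η x.vec z = 0 := by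
          have h := orthProj_spec (ξ := ξ) u.form_vec v.form_vec huv hvu f
          have h' : ξ y.vec (orthProj ξ u.vec v.vec f) = ξ y.vec f :=
            apply_orthProj (hξ.refl _ _ huy) (hξ.refl _ _ hvy) f
          refine ⟨orthProj ξ u.vec v.vec f -
            (η x.vec (orthProj ξ u.vec v.vec f) / η x.vec y.vec) • y.vec, ?_, ?_, ?_, ?_⟩
          · simpa [h', halt] using hf
          · simp [h.1, huy]
          · simp [h.2, hvy]
          · simp [hxy]
        have hyz' : y.vec ∉ Submodule.span F {z} := by
          intro h
          obtain ⟨a, ha⟩ := Submodule.mem_span_singleton.1 h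
          rw [← ha] at hyz
          simp [halt] at hyz
        have hz0 : z ≠ 0 := by rintro rfl; simp at hyz
        obtain ⟨P, hP, hPy, -⟩ := exists_pencil (ξ := ξ) hz0 hyz' fun a => halt _
        have hy : y = P 0 := by
          obtain ⟨c, -, hc⟩ := hPy 0
          refine vec_mem_span.1 (Submodule.mem_span_singleton.2 ⟨c, ?_⟩)
          rw [hc, zero_smul, add_zero]
        have hP0 : ∀ a, a ≠ 0 → P a ≠ y := fun a ha h => ha (hP (h.trans hy))
        have h1 : (1 : F) ≠ -1 := fun h => hξ.two_ne (by linear_combination h)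
        refine ⟨P 1, P (-1), hP0 _ one_ne_zero, hP0 _ (neg_ne_zero.2 one_ne_zero), hP.ne h1, ?_⟩
        obtain ⟨c, hc, hPc⟩ := hPy 1
        obtain ⟨d, hd, hPd⟩ := hPy (-1)
        rw [hPc, hPd]
        simp [hxy, hxz, huy, hvy, huz, hvz, hc, hd]

end PolarPairs

end Veronese

open Veronese in
theorem mainTheorem5 :
    ∃ D : Veronese.IncidenceDefinition,
      ∀ (F : Type*) (V : Type*) [Field F] [AddCommGroup V] [Module F V] [FiniteDimensional F V]
        (ϖ κ : ℙ F V → Set (ℙ F V)),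
        ringChar F ≠ 2 → Veronese.DeterminesPolarSpace ϖ → Veronese.IsSymplecticPolarity κ →
          D.Defines ((Veronese.polarSpace ϖ).veronese 2) (Veronese.polarHyperplane ϖ κ) := by
  refine ⟨veroneseDefinition, fun F V _ _ _ _ ϖ κ hF hϖ hκ => ?_⟩
  have h2 : (2 : F) ≠ 0 := Ring.two_ne_zero hF
  obtain ⟨η, hη, hηalt, hκ⟩ := hκ
  obtain rfl : κ = conjugates η := funext hκ
  obtain ⟨ξ, hξ, rfl⟩ : ∃ ξ : LinearMap.BilinForm F V, IsPolarForm ξ ∧ ϖ = conjugates ξ := by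
    rcases hϖ with ⟨⟨ξ, hξ, halt, h⟩, X, hX⟩ | ⟨⟨ξ, hξ, hsymm, h⟩, X, hX⟩
    · obtain rfl : ϖ = conjugates ξ := funext h
      obtain ⟨U, hU, hT, -⟩ := selfConjSubspaces_iff.1 hX
      exact ⟨ξ, ⟨h2, halt.isRefl, hξ.1, ⟨U, hT, hU.ge⟩, Or.inl halt⟩, rfl⟩
    · obtain rfl : ϖ = conjugates ξ := funext h
      obtain ⟨U, hU, hT, -⟩ := selfConjSubspaces_iff.1 hX
      exact ⟨ξ, ⟨h2, hsymm.isRefl, hξ.1, ⟨U, hT, by omega⟩, Or.inr ⟨hsymm.eq, U, hT, hU.ge⟩⟩, rfl⟩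
  exact (polarPair_of_isPolarForm hξ hηalt hη.1).defines
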